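/- **Setting.** Consider a finite $n$-player extensive-form game with perfect recall, possibly with a chance player: $\mathscr{H}$ is the set of nodes of the game tree, $\mathscr{Z}$ the set of terminal nodes, $u^{(i)}:\mathscr{Z}\to\mathbb{R}$ the payoff of Player $i$, and $p_c(z)$ the product of the probabilities of the chance moves on the path to $z$. For Player $i$, $\mathcal{J}^{(i)}$ is the set of information sets, $\mathscr{A}(j)$ the action set at $j$, $\Sigma^{(i)}_*=\{(j,a):j\in\mathcal{J}^{(i)},a\in\mathscr{A}(j)\}$, $\Sigma^{(i)}=\Sigma_*^{(i)}\cup\{\varnothing\}$ the set of sequences, $\sigma^{(i)}(z)$ and $\sigma^{(i)}(j)$ the last sequence of Player $i$ on the path to $z$, respectively to $j$, and $\preceq$ denotes precedence in the tree. $\Sigma_j^{(i)}=\{\sigma\in\Sigma^{(i)}:\sigma\succeq j\}$. The polytope of sequence-form strategies is $\mathcal{Q}^{(i)}=\{q\in\mathbb{R}_{\ge0}^{\Sigma^{(i)}}: q[\varnothing]=1,\ q[\sigma^{(i)}(j)]=\sum_{a\in\mathscr{A}(j)}q[(j,a)]\ \forall j\}$, $\Pi^{(i)}=\mathcal{Q}^{(i)}\cap\{0,1\}^{\Sigma^{(i)}}$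 and $\Pi=\prod_i\Pi^{(i)}$; $\mathcal{Q}^{(i)}_j$ is the set of $y\in\mathbb{R}_{\ge0}^{\Sigma_j^{(i)}}$ with $\sum_{a\in\mathscr{A}(j)}y[(j,a)]=1$ and $y[\sigma^{(i)}(j')]=\sum_{a\in\mathscr{A}(j')} y[(j',a)]$ for all $j'\succ j$, and $\Pi_j^{(i)}=\mathcal{Q}_j^{(i)}\cap\{0,1\}^{\Sigma_j^{(i)}}$. For $\varepsilon\ge0$, a probability distribution $\mu$ on $\Pi$ is an *$\varepsilon$-EFCE* (approximate extensive-form correlated equilibrium) if for all $i$, $\hat\sigma=(j,a)\in\Sigma_*^{(i)}$ and $\hat\pi\in\Pi_j^{(i)}$, $$\sum_{z:\,\sigma^{(i)}(z)\succeq\hat\sigma}u^{(i)}(z)p_c(z)\,r_\mu(z)\ \ge\ \sum_{z:\,\sigma^{(i)}(z)\succeq j}u^{(i)}(z)p_c(z)\,r^{(i)}_{\mu,\hat\sigma\to\hat\pi}(z)-\varepsilon ,$$ where $r_\mu(z)=\mu\{\pi:\pi^{(k)}[\sigma^{(k)}(z)]=1\ \forall k\}$ and $r^{(i)}_{\mu,\hat\sigma\to\hat\pi}(z)=\mu\{\pi:\pi^{(k)}[\sigma^{(k)}(z)]=1\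 \forall k\ne i,\ \pi^{(i)}[\hat\sigma]=1\}\cdot\hat\pi[\sigma^{(i)}(z)]$. **Algorithm of Player $i$.** For $\hat\sigma=(j,a)\in\Sigma_*^{(i)}$ and $y\in\mathbb{R}^{\Sigma_j^{(i)}}$ let $\phi_{\hat\sigma\to y}$ be the linear map of $\mathbb{R}^{\Sigma^{(i)}}$ given by $\phi_{\hat\sigma\to y}(x)[\sigma]=x[\sigma]\,\mathbf 1[\sigma\not\succeq\hat\sigma]+y[\sigma]\,x[\hat\sigma]\,\mathbf 1[\sigma\succeq j]$. The player runs regret matching on the simplex over $\Sigma_*^{(i)}$, with output $\lambda^t$ at time $t$, and, for each $\hat\sigma=(j,a)\in\Sigma_*^{(i)}$, counterfactual regret minimization (CFR, with regret matching at each information set) on $\mathcal{Q}_j^{(i)}$, with output $q^t_{\hat\sigma}$. Put $\phi^t=\sum_{\hat\sigma}\lambda^t[\hat\sigma]\,\phi_{\hat\sigma\to q^t_{\hat\sigma}}$. A fixed point $q^t=\phi^t(q^t)\in\mathcal{Q}^{(i)}$ is built starting from $x[\varnothing]=1$ and processing the information sets $j^*$ in a top-down order. At $j^*$, with $\sigma_p=\sigma^{(i)}(j^*)$,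 put $x[(j^*,\cdot)]=0$ if $x[\sigma_p]=0$, and otherwise put $x[(j^*,\cdot)]=x[\sigma_p]\,b$, where $b$ is the probability vector returned by a given oracle as a fixed point of the (column-)stochastic matrix $W/x[\sigma_p]$, $$W[a_r,a_c]=r[a_r]+\Big(\lambda_{(j^*,a_c)}q_{(j^*,a_c)}[(j^*,a_r)]+\big(1-\textstyle\sum_{\hat\sigma\preceq(j^*,a_c)}\lambda_{\hat\sigma}\big)\mathbf 1[a_r=a_c]\Big)x[\sigma_p],$$ $$r[a]=\sum_{j'\preceq\sigma_p}\sum_{a'\in\mathscr{A}(j')}\lambda_{(j',a')}\,q_{(j',a')}[(j^*,a)]\,x[(j',a')].$$ The player then draws $\pi^{(i),t}\in\Pi^{(i)}$ by the natural sampling scheme: going down the information sets, at each visited $j$ action $a$ is drawn with probability $q^t[(j,a)]/q^t[\sigma^{(i)}(j)]$. Draws of different players are independent given the past. Finally the player observes the linear utility function $$\ell^{(i),t}(x)=\sum_{z\in\mathscr{Z}}u^{(i)}(z)\,p_c(z)\Big(\prod_{k\ne i}\pi^{(k),t}[\sigma^{(k)}(z)]\Big)x[\sigma^{(i)}(z)]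 ;$$ with $L^t(\phi)=\ell^{(i),t}(\phi(q^t))$, regret matching is fed the utility $\lambda\mapsto\sum_{\hat\sigma}\lambda[\hat\sigma]\,L^t(\phi_{\hat\sigma\to q^t_{\hat\sigma}})$ and the CFR algorithm of $\hat\sigma$ is fed the utility $y\mapsto L^t(\phi_{\hat\sigma\to y})-L^t(\phi_{\hat\sigma\to0})$. **Theorem.** Suppose that all players play according to this algorithm, for any choice of the fixed-point oracles and of the top-down orders. The above defines a probability law of the play, and for all $T\ge1$ and $\delta\in(0,1)$, with probability at least $1-\delta$ the empirical frequency of play $\mu[\pi]=\frac1T\sum_{t=1}^T\mathbf 1[(\pi^{(1),t},\dots,\pi^{(n),t})=\pi]$ is a $$D\,\frac{2|\mathscr{H}|+\sqrt{8\log(n/\delta)}}{\sqrt T}\text{-EFCE},$$ where $D$ is the difference between the maximum and the minimum payoff of the game (over all players and terminal nodes). -/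

import Mathlib

open scoped Classical

universe u

noncomputable section

/-! ## Extensive-form games -/

/-- A finite rooted tree whose edges are labelled by actions. A node is identified with the list of
the actions on the path from the root to it, **the most recent action first**: the root is `[]`, and
playing `a` at `h` leads to `a :: h`. Thus `h` lies on the path from the root to `h'` iff
`h <:+ h'` (`h` is a suffix of `h'`). -/
structure GameTree (A : Type u) where
  nodes : Finset (List A)
  root_mem : [] ∈ nodes
  parent_mem : ∀ a h, a :: h ∈ nodes → h ∈ nodes

/-- The actions available at a node. -/
def GameTree.actions {A : Type u} (t : GameTree A) (h : List A) : Finset A :=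
  (t.nodes.biUnion List.toFinset).filter fun a => a :: h ∈ t.nodes

theorem GameTree.mem_actions {A : Type u} (t : GameTree A) (h : List A) (a : A) :
    a ∈ t.actions h ↔ a :: h ∈ t.nodes := by
  constructor
  · intro ha
    exact (Finset.mem_filter.mp ha).2
  · intro ha
    refine Finset.mem_filter.mpr ⟨Finset.mem_biUnion.mpr ⟨_, ha, ?_⟩, ha⟩
    simp

/-- An `n`-player extensive-form game. The values of `player`, `info`, `chance`, `payoff` matter only
at the nodes where they make sense: `player h` is the player acting at the decision node `h`
(`none` is the chance player), `info h` is the name of the information set of `h` among those of the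
player acting at `h`, `chance h a` is the probability of `a` at the chance node `h`, and `payoff i z`
is the payoff of Player `i` at the terminal node `z`. -/
structure ExtGame (n : ℕ) (A K : Type u) extends GameTree A where
  player : List A → Option (Fin n)
  info : List A → K
  chance : List A → A → ℝ
  payoff : Fin n → List A → ℝ
  same_actions : ∀ h ∈ nodes, ∀ h' ∈ nodes,
    (toGameTree.actions h).Nonempty → (toGameTree.actions h').Nonempty →
    player h ≠ none → player h = player h' → info h = info h' →
    toGameTree.actions h = toGameTree.actions h'
  chance_nonneg : ∀ h ∈ nodes, player h = none → ∀ a ∈ toGameTree.actions h, 0 ≤ chance h a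
  chance_sum : ∀ h ∈ nodes, (toGameTree.actions h).Nonempty → player h = none →
    ∑ a ∈ toGameTree.actions h, chance h a = 1

namespace ExtGame

variable {n : ℕ} {A K : Type u} (G : ExtGame n A K)

/-- The decision nodes of Player `i`. -/
def decisionNodes (i : Fin n) : Finset (List A) :=
  G.nodes.filter fun h => (G.actions h).Nonempty ∧ G.player h = some i

/-- The terminal nodes. -/
def terminals : Finset (List A) := G.nodes.filter fun h => G.actions h = ∅

abbrev Terminal : Type u := {z : List A // z ∈ G.terminals}

/-- The information sets of Player `i` (the names of the classes of the information partition). -/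
abbrev InfoSet (i : Fin n) : Type u := {k : K // k ∈ (G.decisionNodes i).image G.info}

variable {G} in
/-- The nodes that belong to an information set. -/
def nodesOf {i : Fin n} (j : G.InfoSet i) : Finset (List A) :=
  (G.decisionNodes i).filter fun h => G.info h = j.1

variable {G} in
/-- The actions available at an information set, that is, at any one of its nodes. -/
def infoActions {i : Fin n} (j : G.InfoSet i) : Finset A := (nodesOf j).biUnion G.actions

abbrev Act {i : Fin n} (j : G.InfoSet i) : Type u := {a : A // a ∈ infoActions j}

/-- The set `Σ_*` of nonempty sequences `(j, a)` of Player `i`. -/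
abbrev NSeq (i : Fin n) : Type u := (j : G.InfoSet i) × G.Act j

/-- The set `Σ` of sequences of Player `i`; `none` is the empty sequence. -/
abbrev Sequence (i : Fin n) : Type u := Option (G.NSeq i)

/-- The sequence of (information set, action) pairs of Player `i` met on the path to `h`, the most
recent pair first. -/
def experience (i : Fin n) : List A → List (K × A)
  | [] => []
  | a :: h => if G.player h = some i then (G.info h, a) :: experience i h else experience i h

/-- Perfect recall: at all nodes of an information set, the acting player has gone through the same
own information sets and has played the same own actions. -/
def PerfectRecall : Prop :=
  ∀ i : Fin n, ∀ h ∈ G.decisionNodes i, ∀ h' ∈ G.decisionNodes i,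
    G.info h = G.info h' → G.experience i h = G.experience i h'

theorem mem_decisionNodes_of_cons {i : Fin n} {a : A} {h : List A} (hm : a :: h ∈ G.nodes)
    (hp : G.player h = some i) : h ∈ G.decisionNodes i :=
  Finset.mem_filter.mpr ⟨G.parent_mem a h hm, ⟨a, (G.mem_actions h a).mpr hm⟩, hp⟩

/-- `σ⁽ⁱ⁾(h)`: the last sequence of Player `i` on the path from the root to the node `h`. -/
def lastSeq (i : Fin n) : (h : List A) → h ∈ G.nodes → G.Sequence i
  | [], _ => none
  | a :: h, hm =>
    if hp : G.player h = some i then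
      some ⟨⟨G.info h, Finset.mem_image_of_mem _ (G.mem_decisionNodes_of_cons hm hp)⟩,
        ⟨a, Finset.mem_biUnion.mpr ⟨h, Finset.mem_filter.mpr
          ⟨G.mem_decisionNodes_of_cons hm hp, rfl⟩, (G.mem_actions h a).mpr hm⟩⟩⟩
    else lastSeq i h (G.parent_mem a h hm)

/-- `σ⁽ⁱ⁾(z)` for a terminal node `z`. -/
def termSeq (i : Fin n) (z : G.Terminal) : G.Sequence i :=
  G.lastSeq i z.1 (Finset.mem_filter.mp z.2).1

/-- The product of the probabilities of the chance moves on the path to a node. -/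
def chanceReach : List A → ℝ
  | [] => 1
  | a :: h => if G.player h = none then G.chance h a * chanceReach h else chanceReach h

/-- The maximum payoff (over players and terminal nodes) minus the minimum payoff. -/
def payoffRange : ℝ :=
  (⨆ x : Fin n × G.Terminal, G.payoff x.1 x.2.1) - ⨅ x : Fin n × G.Terminal, G.payoff x.1 x.2.1

variable {G} {i : Fin n}

/-- `σ⁽ⁱ⁾(j)`: the last sequence of Player `i` on the path to any node of `j` (one node is picked; with
perfect recall the result does not depend on it). -/
def parentSeq (j : G.InfoSet i) : G.Sequence i :=
  G.lastSeq i (Finset.mem_image.mp j.2).choose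
    (Finset.mem_filter.mp (Finset.mem_image.mp j.2).choose_spec.1).1

/-- `j ⪯ j'` for information sets. -/
def InfoLE (j j' : G.InfoSet i) : Prop := ∃ h ∈ nodesOf j, ∃ h' ∈ nodesOf j', h <:+ h'

/-- `j ⪯ σ` for an information set and a sequence. -/
def InfoLESeq (j : G.InfoSet i) : G.Sequence i → Prop
  | none => False
  | some τ => InfoLE j τ.1

/-- `σ ⪯ σ'` for sequences. -/
def SeqLE : G.Sequence i → G.Sequence i → Prop
  | none, _ => True
  | some _, none => False
  | some τ, some τ' => τ = τ' ∨ ∃ h ∈ nodesOf τ.1, ∃ h' ∈ nodesOf τ'.1, (τ.2.1 :: h) <:+ h'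

/-- The set `Σ_j` of the sequences at `j` and at its descendants. -/
abbrev SubSeq (j : G.InfoSet i) : Type u := {τ : G.NSeq i // InfoLE j τ.1}

/-- The entry of `y ∈ ℝ^{Σ_j}` at a sequence (zero for the sequences outside `Σ_j`). -/
def entry {j : G.InfoSet i} (y : SubSeq j → ℝ) : G.Sequence i → ℝ
  | none => 0
  | some τ => if hτ : InfoLE j τ.1 then y ⟨τ, hτ⟩ else 0

variable (G) in
/-- The sequence-form strategy polytope of Player `i`. -/
def seqPolytope (i : Fin n) : Set (G.Sequence i → ℝ) :=
  {q | (∀ σ, 0 ≤ q σ) ∧ q none = 1 ∧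
    ∀ j : G.InfoSet i, q (parentSeq j) = ∑ a : G.Act j, q (some ⟨j, a⟩)}

/-- The sequence-form strategies for the subtree rooted at `j`. -/
def subPolytope (j : G.InfoSet i) : Set (SubSeq j → ℝ) :=
  {y | (∀ τ, 0 ≤ y τ) ∧ ∑ a : G.Act j, entry y (some ⟨j, a⟩) = 1 ∧
    ∀ j' : G.InfoSet i, InfoLE j j' → j' ≠ j →
      entry y (parentSeq j') = ∑ a : G.Act j', entry y (some ⟨j', a⟩)}

/-- The deterministic sequence-form strategies for the subtree rooted at `j`. -/
def subPure (j : G.InfoSet i) : Set (SubSeq j → ℝ) :=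
  {y | y ∈ subPolytope j ∧ ∀ τ, y τ = 0 ∨ y τ = 1}

variable (G) in
/-- The deterministic sequence-form strategies of Player `i`. -/
def pureSet (i : Fin n) : Set (G.Sequence i → ℝ) :=
  {q | q ∈ G.seqPolytope i ∧ ∀ σ, q σ = 0 ∨ q σ = 1}

variable (G) in
abbrev PureStrategy (i : Fin n) : Type u := {p : G.Sequence i → ℝ // p ∈ G.pureSet i}

variable (G) in
/-- Joint deterministic sequence-form strategies. -/
abbrev Profile : Type u := (i : Fin n) → G.PureStrategy i

instance : Finite (G.PureStrategy i) := by
  have h : (Set.pi Set.univ fun _ : G.Sequence i => ({0, 1} : Set ℝ)).Finite :=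
    Set.Finite.pi fun _ => Set.toFinite _
  exact (h.subset fun p hp σ _ => by simpa using hp.2 σ).to_subtype

instance : Fintype (G.PureStrategy i) := Fintype.ofFinite _

/-! ## Extensive-form correlated equilibrium -/

/-- The probability of reaching `z` (chance aside) when all players follow the recommendations. -/
def reach (μ : G.Profile → ℝ) (z : G.Terminal) : ℝ :=
  ∑ p : G.Profile with (∀ i, (p i).1 (G.termSeq i z) = 1), μ p

/-- The probability that the `(τ, y)`-trigger agent of Player `i` reaches `z` (chance aside). -/
def triggerReach (μ : G.Profile → ℝ) (τ : G.NSeq i) (y : SubSeq τ.1 → ℝ) (z : G.Terminal) : ℝ :=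
  (∑ p : G.Profile with ((∀ i', i' ≠ i → (p i').1 (G.termSeq i' z) = 1) ∧ (p i).1 (some τ) = 1), μ p)
    * entry y (G.termSeq i z)

/-- `μ` is a probability distribution on joint deterministic strategies that is an `ε`-EFCE. -/
def IsEFCE (ε : ℝ) (μ : G.Profile → ℝ) : Prop :=
  0 ≤ ε ∧ μ ∈ stdSimplex ℝ G.Profile ∧
    ∀ (i : Fin n) (τ : G.NSeq i), ∀ y ∈ subPure τ.1,
      (∑ z : G.Terminal with SeqLE (some τ) (G.termSeq i z),
          G.payoff i z.1 * G.chanceReach z.1 * reach μ z) ≥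
        (∑ z : G.Terminal with InfoLESeq τ.1 (G.termSeq i z),
          G.payoff i z.1 * G.chanceReach z.1 * triggerReach μ τ y z) - ε

/-- The empirical frequency of play. -/
def empirical {T : ℕ} (x : Fin T → G.Profile) (p : G.Profile) : ℝ :=
  (1 / (T : ℝ)) * ∑ t : Fin T, if x t = p then 1 else 0

/-! ## Trigger deviation functions -/

/-- The matrix of the canonical trigger deviation function with trigger `τ`, continuation `y`. -/
def trigMatrix (τ : G.NSeq i) (y : SubSeq τ.1 → ℝ) : Matrix (G.Sequence i) (G.Sequence i) ℝ :=
  Matrix.of fun r c =>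
    if ¬ SeqLE (some τ) c ∧ r = c then 1
    else if c = some τ ∧ InfoLESeq τ.1 r then entry y r
    else 0

/-- The canonical trigger deviation function. -/
def trigMap (τ : G.NSeq i) (y : SubSeq τ.1 → ℝ) :
    (G.Sequence i → ℝ) →ₗ[ℝ] (G.Sequence i → ℝ) :=
  (trigMatrix τ y).mulVecLin

theorem entry_lin {j : G.InfoSet i} (b c : ℝ) (x y : SubSeq j → ℝ) (σ : G.Sequence i) :
    entry (b • x + c • y) σ = b * entry x σ + c * entry y σ := by
  cases σ with
  | none => simp [entry]
  | some τ => by_cases hτ : InfoLE j τ.1 <;> simp [entry, hτ]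

theorem trigMatrix_lin (τ : G.NSeq i) (b c : ℝ) (x y : SubSeq τ.1 → ℝ) :
    trigMatrix τ (b • x + c • y) - trigMatrix τ 0 =
      b • (trigMatrix τ x - trigMatrix τ 0) + c • (trigMatrix τ y - trigMatrix τ 0) := by
  have h0 : ∀ σ, entry (0 : SubSeq τ.1 → ℝ) σ = 0 := fun σ => by
    simpa using entry_lin 0 0 (0 : SubSeq τ.1 → ℝ) 0 σ
  ext r s
  simp only [trigMatrix, Matrix.sub_apply, Matrix.add_apply, Matrix.smul_apply, Matrix.of_apply,
    entry_lin, h0, smul_eq_mul]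
  split_ifs <;> ring

theorem trigMap_lin (τ : G.NSeq i) (b c : ℝ) (x y : SubSeq τ.1 → ℝ) :
    trigMap τ (b • x + c • y) - trigMap τ 0 =
      b • (trigMap τ x - trigMap τ 0) + c • (trigMap τ y - trigMap τ 0) := by
  have h := congrArg Matrix.mulVecLin (trigMatrix_lin τ b c x y)
  apply LinearMap.ext
  intro v
  have h' := congrArg (fun f => f v) h
  simpa [trigMap, Matrix.sub_mulVec, Matrix.add_mulVec, Matrix.smul_mulVec] using h'

/-- The linear utility function `y ↦ L (φ_{τ → y}) - L (φ_{τ → 0})` on `ℝ^{Σ_j}`, for a linear utility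
function `L` of transformations. -/
def shiftedUtility (τ : G.NSeq i)
    (L : ((G.Sequence i → ℝ) →ₗ[ℝ] (G.Sequence i → ℝ)) →ₗ[ℝ] ℝ) :
    (SubSeq τ.1 → ℝ) →ₗ[ℝ] ℝ where
  toFun y := L (trigMap τ y) - L (trigMap τ 0)
  map_add' x y := by
    have h := congrArg L (trigMap_lin τ 1 1 x y)
    simpa using h
  map_smul' c x := by
    have h := congrArg L (trigMap_lin τ c 0 x 0)
    simpa using h

end ExtGame

/-! ## Regret minimizers -/

/-- An online decision algorithm: it alternates between returning an element (`next`) and observing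
a linear utility function (`observe`). Here `X` is the type in which its outputs are represented and
`E` is the vector space on which the utility functions are defined. -/
structure OnlineAlg (X E : Type u) [AddCommGroup E] [Module ℝ E] where
  State : Type u
  init : State
  next : State → X
  observe : State → (E →ₗ[ℝ] ℝ) → State

/-- The point of the simplex proportional to the positive parts of the cumulative regrets `R`
(uniform if no regret is positive). -/
def rmStrategy {ι : Type u} [Fintype ι] (R : ι → ℝ) (a : ι) : ℝ :=
  if (∑ b, max (R b) 0) = 0 then 1 / (Fintype.card ι : ℝ) else max (R a) 0 / ∑ b, max (R b) 0

/-- Update of the cumulative regrets after the utilities `v` have been observed. -/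
def rmUpdate {ι : Type u} [Fintype ι] (R v : ι → ℝ) (a : ι) : ℝ :=
  R a + (v a - ∑ b, rmStrategy R b * v b)

/-- Regret matching on the simplex over `ι`. -/
def regretMatching (ι : Type u) [Fintype ι] : OnlineAlg (ι → ℝ) (ι → ℝ) where
  State := ι → ℝ
  init := 0
  next := rmStrategy
  observe R ℓ := rmUpdate R fun a => ℓ (Pi.single a 1)

namespace ExtGame

variable {n : ℕ} {A K : Type u} {G : ExtGame n A K} {i : Fin n}

/-- `(j', a) ∈ Σ_j`, for `(j', a') ∈ Σ_j` and another action `a` at `j'`. -/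
def SubSeq.withAct {j : G.InfoSet i} (τ : SubSeq j) (a : G.Act τ.1.1) : SubSeq j :=
  ⟨⟨τ.1.1, a⟩, τ.2⟩

/-- The probabilities of the actions prescribed by regret matching at all the information sets of the
subtree rooted at `j`, given the cumulative counterfactual regrets `R`. -/
def cfrBehavior {j : G.InfoSet i} (R : SubSeq j → ℝ) (τ : SubSeq j) : ℝ :=
  rmStrategy (fun a => R (τ.withAct a)) τ.1.2

/-- The sequence-form representation of a behavioral strategy `b` of the subtree rooted at `j`. -/
def toSeqForm {j : G.InfoSet i} (b : SubSeq j → ℝ) (τ : SubSeq j) : ℝ :=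
  ∏ ρ : SubSeq j with SeqLE (some ρ.1) (some τ.1), b ρ

/-- Counterfactual utility of the action `a'` at `j'`, where `τ = (j', a')`: the utility collected at
`τ` and at its successors if `a'` is played at `j'`, and `b` is followed afterwards. -/
def cfValue {j : G.InfoSet i} (b : SubSeq j → ℝ) (g : (SubSeq j → ℝ) →ₗ[ℝ] ℝ) (τ : SubSeq j) : ℝ :=
  ∑ τ' : SubSeq j with SeqLE (some τ.1) (some τ'.1),
    g (Pi.single τ' 1) *
      ∏ ρ : SubSeq j with
        (SeqLE (some τ.1) (some ρ.1) ∧ ρ ≠ τ ∧ SeqLE (some ρ.1) (some τ'.1)), b ρ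

/-- Counterfactual regret minimization (CFR) for the sequence-form strategies of the subtree rooted at
`j`: one regret matching per information set, fed with the counterfactual utilities. -/
def cfr (j : G.InfoSet i) : OnlineAlg (SubSeq j → ℝ) (SubSeq j → ℝ) where
  State := SubSeq j → ℝ
  init := 0
  next R := toSeqForm (cfrBehavior R)
  observe R g := fun τ =>
    rmUpdate (fun a => R (τ.withAct a)) (fun a => cfValue (cfrBehavior R) g (τ.withAct a)) τ.1.2

/-- Regret minimizer for the trigger deviation functions with trigger `τ = (j, a)` and any continuation
strategy in the polytope of `j`. The output `trigMap τ y` is represented by `y`. -/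
def trigAlg (τ : G.NSeq i) :
    OnlineAlg (SubSeq τ.1 → ℝ) ((G.Sequence i → ℝ) →ₗ[ℝ] (G.Sequence i → ℝ)) where
  State := (cfr τ.1).State
  init := (cfr τ.1).init
  next := (cfr τ.1).next
  observe s L := (cfr τ.1).observe s (shiftedUtility τ L)

variable (G) in
/-- The representation `{(λ_τ, y_τ)}` of the transformation `∑ τ, λ_τ • trigMap τ y_τ`. -/
abbrev TransRep (i : Fin n) : Type u := (G.NSeq i → ℝ) × ((τ : G.NSeq i) → SubSeq τ.1 → ℝ)

variable (G) in
/-- Regret minimizer for the convex hull of all trigger deviation functions of Player `i`. -/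
def hullAlg (i : Fin n) :
    OnlineAlg (G.TransRep i) ((G.Sequence i → ℝ) →ₗ[ℝ] (G.Sequence i → ℝ)) where
  State := (regretMatching (G.NSeq i)).State × ((τ : G.NSeq i) → (trigAlg τ).State)
  init := ((regretMatching (G.NSeq i)).init, fun τ => (trigAlg τ).init)
  next s := ((regretMatching (G.NSeq i)).next s.1, fun τ => (trigAlg τ).next (s.2 τ))
  observe s L :=
    ((regretMatching (G.NSeq i)).observe s.1
        (∑ τ : G.NSeq i, L (trigMap τ ((trigAlg τ).next (s.2 τ))) •
          (LinearMap.proj τ : (G.NSeq i → ℝ) →ₗ[ℝ] ℝ)),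
      fun τ => (trigAlg τ).observe (s.2 τ) L)

variable (G) in
/-- A choice of a fixed point for every matrix indexed by the actions of an information set. -/
abbrev Oracle : Type u :=
  (i : Fin n) → (j : G.InfoSet i) → Matrix (G.Act j) (G.Act j) ℝ → (G.Act j → ℝ)

/-- The oracle returns a fixed point in the simplex of every (column-)stochastic matrix. -/
def Oracle.Correct (F : G.Oracle) : Prop :=
  ∀ (i : Fin n) (j : G.InfoSet i) (M : Matrix (G.Act j) (G.Act j) ℝ),
    (∀ r c, 0 ≤ M r c) → (∀ c, ∑ r, M r c = 1) →
      F i j M ∈ stdSimplex ℝ (G.Act j) ∧ M.mulVec (F i j M) = F i j M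

/-- The enumeration `l` of the information sets of Player `i` is in a top-down order. -/
def TopDown (l : List (G.InfoSet i)) : Prop :=
  l.Nodup ∧ (∀ j, j ∈ l) ∧ l.Pairwise fun j j' => ¬ InfoLE j' j

/-- The vector `r` of the procedure `extend`. -/
def extendVec (φ : G.TransRep i) (x : G.Sequence i → ℝ) (j : G.InfoSet i) (a : G.Act j) : ℝ :=
  ∑ τ : G.NSeq i with InfoLESeq τ.1 (parentSeq j),
    φ.1 τ * entry (φ.2 τ) (some ⟨j, a⟩) * x (some τ)

/-- The matrix `W` of the procedure `extend`. -/
def extendMatrix (φ : G.TransRep i) (x : G.Sequence i → ℝ) (j : G.InfoSet i) :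
    Matrix (G.Act j) (G.Act j) ℝ :=
  Matrix.of fun r c =>
    extendVec φ x j r +
      (φ.1 ⟨j, c⟩ * entry (φ.2 ⟨j, c⟩) (some ⟨j, r⟩) +
        (1 - ∑ τ : G.NSeq i with SeqLE (some τ) (some ⟨j, c⟩), φ.1 τ) * (if r = c then 1 else 0)) *
      x (parentSeq j)

/-- The new entries at `j` computed by the procedure `extend`. -/
def extendEntries (F : G.Oracle) (φ : G.TransRep i) (x : G.Sequence i → ℝ) (j : G.InfoSet i) :
    G.Act j → ℝ :=
  if x (parentSeq j) = 0 then 0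
  else x (parentSeq j) • F i j ((x (parentSeq j))⁻¹ • extendMatrix φ x j)

/-- Extension of a partial fixed point `x` of `φ` to the information set `j`. -/
def extend (F : G.Oracle) (φ : G.TransRep i) (x : G.Sequence i → ℝ) (j : G.InfoSet i) :
    G.Sequence i → ℝ
  | none => x none
  | some ⟨j', a⟩ => if hj : j' = j then extendEntries F φ x j (hj ▸ a) else x (some ⟨j', a⟩)

/-- The fixed point of `φ`, constructed information set by information set in the order `l`. -/
def fixedPoint (F : G.Oracle) (l : List (G.InfoSet i)) (φ : G.TransRep i) : G.Sequence i → ℝ :=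
  l.foldl (extend F φ) (Pi.single none 1)

/-- Phi-regret minimizer for mixed sequence-form strategies: it plays the fixed point `q` of the current
transformation, and feeds `φ ↦ ℓ (φ q)` to the regret minimizer of transformations. -/
def mixedAlg (F : G.Oracle) (l : List (G.InfoSet i)) :
    OnlineAlg (G.Sequence i → ℝ) (G.Sequence i → ℝ) where
  State := (G.hullAlg i).State
  init := (G.hullAlg i).init
  next s := fixedPoint F l ((G.hullAlg i).next s)
  observe s ℓ := (G.hullAlg i).observe s
    (ℓ ∘ₗ LinearMap.applyₗ (fixedPoint F l ((G.hullAlg i).next s)))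

/-- The probability that the natural sampling scheme, run on `q`, returns the deterministic strategy
`p`. The scheme goes down the information sets of the player, and at every information set `j` that it
visits it draws the action `a` with probability `q[(j, a)] / q[σ(j)]`; the pairs `(j, a)` drawn on the
way are those with `p[(j, a)] = 1`. -/
def naturalSampling (q : G.Sequence i → ℝ) (p : G.PureStrategy i) : ℝ :=
  ∏ τ : G.NSeq i with p.1 (some τ) = 1, q (some τ) / q (parentSeq τ.1)

/-! ## Repeated play -/

/-- The linear utility function of Player `i` given the strategies of the other players in `p`. -/
def utility (i : Fin n) (p : G.Profile) : (G.Sequence i → ℝ) →ₗ[ℝ] ℝ :=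
  ∑ z : G.Terminal,
    (G.payoff i z.1 * G.chanceReach z.1 *
        ∏ i' ∈ Finset.univ.erase i, (p i').1 (G.termSeq i' z)) •
      (LinearMap.proj (G.termSeq i z) : (G.Sequence i → ℝ) →ₗ[ℝ] ℝ)

/-- The states of the algorithms of all the players after the given profiles (in chronological order)
have been played. -/
def stateAfter (F : G.Oracle) (ord : (i : Fin n) → List (G.InfoSet i)) (hist : List G.Profile) :
    (i : Fin n) → (mixedAlg F (ord i)).State :=
  hist.foldl (fun s p i => (mixedAlg F (ord i)).observe (s i) (utility i p))
    (fun i => (mixedAlg F (ord i)).init)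

/-- The probability that the profiles played in the first `T` repetitions are `x 0, …, x (T - 1)`: at
every repetition every player draws, independently of the other players, a deterministic strategy by
applying the natural sampling scheme to the current mixed strategy of their algorithm. -/
def playProb (F : G.Oracle) (ord : (i : Fin n) → List (G.InfoSet i)) {T : ℕ}
    (x : Fin T → G.Profile) : ℝ :=
  ∏ t : Fin T, ∏ i : Fin n,
    naturalSampling
      ((mixedAlg F (ord i)).next (stateAfter F ord ((List.ofFn x).take t) i)) (x t i)

/-- The law of the profiles played in the first `T` repetitions. -/
def playLaw (F : G.Oracle) (ord : (i : Fin n) → List (G.InfoSet i)) (T : ℕ) :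
    MeasureTheory.Measure (Fin T → G.Profile) :=
  ∑ x : Fin T → G.Profile, ENNReal.ofReal (playProb F ord x) • MeasureTheory.Measure.dirac x

end ExtGame

end

/-!
All payoffs enter through the linear gains `devGain`: the empirical frequency of play is an `ε`-EFCE
if and only if, for every player and every deterministic trigger deviation `φ`, the total gain
`∑ t, ℓᵗ (φ πᵗ) - ℓᵗ πᵗ` of the sampled strategies is at most `ε T` (`isEFCE_empirical_iff`). This gain
is split into the gain of the mixed strategies `qᵗ` and a martingale.

*Gain of the mixed strategies.* Under perfect recall the order on sequences and information sets is
generated by `parentSeq`, which makes all the arguments inductions on a forest. The utility of a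
sequence-form strategy is an average of payoffs (`utility_mem_Icc`), because the reach probabilities
are a flow on the game tree, and trigger deviations preserve the polytope
(`trigMap_mem_seqPolytope`); hence all utilities that occur differ by at most the payoff range `D`.
The procedure `extend` solves the fixed-point equations one information set at a time
(`sum_smul_trigMap_fixedPoint`), so that regret matching over the triggers is charged against the
utility of `qᵗ` itself. For CFR, the regret against `y` is `∑ τ, y τ * R τ` for the cumulative
counterfactual regrets `R` (`sum_mul_cfRegret`, a telescoping sum along the chains of predecessors),
and each instantaneous counterfactual regret is at most `D`, because it is the difference of the
utilities of two continuation strategies that play towards the information set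
(`abs_cfRegret_le`). With the usual potential argument for regret matching, a player with `N`
sequences has total regret at most `D √T (√N + N)` (`sum_devGain_mixed_le`).

*Martingale.* The natural sampling scheme is the image of independent draws at all information sets
(`naturalSampling_eq_sum`), hence unbiased, also conditionally on the draws of the other players.
Hoeffding's lemma and the Chernoff bound give, for a fixed `φ`, a deviation above `D √T B` with
probability at most `exp (-B² / 2)` (`sum_pathWeight_filter_le`).

*Union bound.* A player has at most `N 2 ^ N` deterministic trigger deviations. Since the game tree
has at least `N + 1` nodes, the term `2 |H|` of the bound exceeds the regret term `√N + N` by at least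
`(N + 3) / 2`, and `N 2 ^ N ≤ exp (((N + 3) / 2)² / 2)`; so the union over the deviations is
paid for by this excess, and the term `√(8 log (n / δ))` pays for the union over the players.
-/

/-! ### Auxiliary facts on lists and finite sums -/

theorem take_ofFn_castSucc {α : Type*} {T t : ℕ} (x : Fin (T + 1) → α) (ht : t ≤ T) :
    (List.ofFn x).take t = (List.ofFn fun s : Fin T => x s.castSucc).take t := by
  rw [List.ofFn_succ', List.concat_eq_append, List.take_append_of_le_length (by simpa using ht)]

theorem ofFn_succ_eq_append {α : Type*} {T : ℕ} (x : Fin (T + 1) → α) :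
    List.ofFn x = (List.ofFn fun s : Fin T => x s.castSucc) ++ [x (Fin.last T)] := by
  rw [List.ofFn_succ', List.concat_eq_append]

theorem sum_filter_exists_le {ι α : Type*} [Fintype ι] [Fintype α] (Q : ι → α → Prop)
    [DecidablePred fun x => ∃ k, Q k x] [∀ k, DecidablePred (Q k)] {f : α → ℝ}
    (hf : ∀ x, 0 ≤ f x) : ∑ x with (∃ k, Q k x), f x ≤ ∑ k, ∑ x with Q k x, f x := by
  simp only [Finset.sum_filter]
  rw [Finset.sum_comm]
  refine Finset.sum_le_sum fun x _ => ?_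
  have h0 : ∀ k ∈ Finset.univ, 0 ≤ if Q k x then f x else 0 := fun k _ => by
    split_ifs
    · exact hf x
    · exact le_rfl
  split_ifs with h
  · obtain ⟨k, hk⟩ := h
    calc f x = if Q k x then f x else 0 := (if_pos hk).symm
      _ ≤ _ := Finset.single_le_sum (f := fun k => if Q k x then f x else 0) h0
        (Finset.mem_univ k)
  · exact Finset.sum_nonneg h0

namespace ExtGame

variable {n : ℕ} {A K : Type u} {G : ExtGame n A K} {i : Fin n}

/-! ### Sequences, information sets and perfect recall -/

theorem mem_nodes_of_suffix {h h' : List A} (hs : h <:+ h') (hm : h' ∈ G.nodes) :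
    h ∈ G.nodes := by
  induction h' with
  | nil => rw [List.suffix_nil] at hs; exact hs ▸ hm
  | cons a t ih =>
    rcases List.suffix_cons_iff.mp hs with rfl | hs
    · exact hm
    · exact ih hs (G.parent_mem a t hm)

theorem mem_nodesOf {j : G.InfoSet i} {h : List A} :
    h ∈ nodesOf j ↔ h ∈ G.decisionNodes i ∧ G.info h = j.1 := by
  simp only [nodesOf, Finset.mem_filter]

theorem mem_nodes_of_mem_decisionNodes {h : List A} (hh : h ∈ G.decisionNodes i) :
    h ∈ G.nodes :=
  (Finset.mem_filter.mp hh).1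

theorem mem_experience {h' : List A} {k : K} {a : A} :
    (k, a) ∈ G.experience i h' ↔
      ∃ h, (a :: h) <:+ h' ∧ G.player h = some i ∧ G.info h = k := by
  induction h' with
  | nil => simp [experience]
  | cons b t ih =>
    unfold experience
    split_ifs with hp
    · rw [List.mem_cons, ih]
      constructor
      · rintro (h | ⟨h, hs, h1, h2⟩)
        · obtain ⟨rfl, rfl⟩ := Prod.mk.inj h
          exact ⟨t, List.suffix_rfl, hp, rfl⟩
        · exact ⟨h, hs.trans (List.suffix_cons _ _), h1, h2⟩
      · rintro ⟨h, hs, h1, h2⟩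
        rcases List.suffix_cons_iff.mp hs with h3 | h3
        · obtain ⟨rfl, rfl⟩ := List.cons.inj h3
          exact Or.inl (by rw [h2])
        · exact Or.inr ⟨h, h3, h1, h2⟩
    · rw [ih]
      constructor
      · rintro ⟨h, hs, h1, h2⟩
        exact ⟨h, hs.trans (List.suffix_cons _ _), h1, h2⟩
      · rintro ⟨h, hs, h1, h2⟩
        rcases List.suffix_cons_iff.mp hs with h3 | h3
        · obtain ⟨rfl, rfl⟩ := List.cons.inj h3
          exact absurd h1 hp
        · exact ⟨h, h3, h1, h2⟩

/-- A nonempty sequence as a bare pair (name of the information set, action), the form in which it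
occurs in `experience`. -/
def code (τ : G.NSeq i) : K × A := (τ.1.1, τ.2.1)

theorem code_injective : Function.Injective (code : G.NSeq i → K × A) := by
  rintro ⟨⟨k, hk⟩, ⟨a, ha⟩⟩ ⟨⟨k', hk'⟩, ⟨a', ha'⟩⟩ h
  obtain ⟨h1, h2⟩ := Prod.mk.inj h
  change k = k' at h1
  change a = a' at h2
  subst h1
  subst h2
  rfl

/-- The last sequence on the path to a node is the head of the experience at that node. -/
theorem map_code_lastSeq {h : List A} (hm : h ∈ G.nodes) :
    (G.lastSeq i h hm).map code = (G.experience i h).head? := by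
  induction h with
  | nil => rfl
  | cons a t ih =>
    unfold lastSeq experience
    split_ifs with hp
    · rfl
    · exact ih _

theorem lastSeq_congr {h h' : List A} (hm : h ∈ G.nodes) (hm' : h' ∈ G.nodes)
    (he : G.experience i h = G.experience i h') : G.lastSeq i h hm = G.lastSeq i h' hm' := by
  apply Option.map_injective code_injective
  rw [map_code_lastSeq, map_code_lastSeq, he]

/-- The experience at (a chosen node of) an information set. -/
noncomputable def infoExp (j : G.InfoSet i) : List (K × A) :=
  G.experience i (Finset.mem_image.mp j.2).choose

theorem choose_mem_nodesOf (j : G.InfoSet i) : (Finset.mem_image.mp j.2).choose ∈ nodesOf j :=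
  mem_nodesOf.mpr (Finset.mem_image.mp j.2).choose_spec

theorem experience_eq_infoExp (hG : G.PerfectRecall) {j : G.InfoSet i} {h : List A}
    (hh : h ∈ nodesOf j) : G.experience i h = infoExp j := by
  have h0 := choose_mem_nodesOf j
  rw [mem_nodesOf] at hh h0
  exact hG i _ hh.1 _ h0.1 (hh.2.trans h0.2.symm)

theorem lastSeq_eq_parentSeq (hG : G.PerfectRecall) {j : G.InfoSet i} {h : List A}
    (hh : h ∈ nodesOf j) (hm : h ∈ G.nodes) : G.lastSeq i h hm = parentSeq j :=
  lastSeq_congr _ _ (experience_eq_infoExp hG hh)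

theorem actions_eq_infoActions {j : G.InfoSet i} {h : List A} (hh : h ∈ nodesOf j) :
    G.actions h = infoActions j := by
  apply Finset.Subset.antisymm
  · exact Finset.subset_biUnion_of_mem G.actions hh
  · refine Finset.biUnion_subset.mpr fun h' hh' => ?_
    rw [mem_nodesOf] at hh hh'
    obtain ⟨h1, h2⟩ := hh
    obtain ⟨h3, h4⟩ := hh'
    obtain ⟨n1, a1, p1⟩ := Finset.mem_filter.mp h1
    obtain ⟨n2, a2, p2⟩ := Finset.mem_filter.mp h3
    rw [G.same_actions h' n2 h n1 a2 a1 (by simp [p2]) (p2.trans p1.symm) (h4.trans h2.symm)]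

instance (j : G.InfoSet i) : Nonempty (G.Act j) := by
  have h := choose_mem_nodesOf j
  obtain ⟨a, ha⟩ := (Finset.mem_filter.mp (mem_nodesOf.mp h).1).2.1
  exact ⟨⟨a, actions_eq_infoActions h ▸ ha⟩⟩

theorem exists_cons_suffix_iff (hG : G.PerfectRecall) (τ : G.NSeq i) (j : G.InfoSet i) :
    (∃ h ∈ nodesOf τ.1, ∃ h' ∈ nodesOf j, (τ.2.1 :: h) <:+ h') ↔ code τ ∈ infoExp j := by
  constructor
  · rintro ⟨h, hh, h', hh', hs⟩
    rw [← experience_eq_infoExp hG hh']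
    rw [mem_nodesOf] at hh
    exact mem_experience.mpr ⟨h, hs, (Finset.mem_filter.mp hh.1).2.2, hh.2⟩
  · intro hc
    have h0 := choose_mem_nodesOf j
    obtain ⟨h, hs, hp, hi⟩ := mem_experience.mp hc
    refine ⟨h, mem_nodesOf.mpr ⟨?_, hi⟩, _, h0, hs⟩
    exact G.mem_decisionNodes_of_cons
      (mem_nodes_of_suffix hs (mem_nodes_of_mem_decisionNodes (mem_nodesOf.mp h0).1)) hp

theorem seqLE_lastSeq (hG : G.PerfectRecall) (τ : G.NSeq i) {h : List A} (hm : h ∈ G.nodes) :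
    SeqLE (some τ) (G.lastSeq i h hm) ↔ code τ ∈ G.experience i h := by
  induction h with
  | nil => simp [lastSeq, experience, SeqLE]
  | cons a t ih =>
    unfold lastSeq experience
    split_ifs with hp
    · have ht := G.mem_decisionNodes_of_cons hm hp
      refine Iff.trans (or_congr_right (exists_cons_suffix_iff hG τ _)) ?_
      rw [← experience_eq_infoExp hG (mem_nodesOf.mpr ⟨ht, rfl⟩), List.mem_cons]
      exact or_congr_left code_injective.eq_iff.symm
    · exact ih _

/-- Precedence of sequences is generated by `parentSeq`. -/
theorem seqLE_some_iff (hG : G.PerfectRecall) (τ τ' : G.NSeq i) :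
    SeqLE (some τ) (some τ') ↔ τ = τ' ∨ SeqLE (some τ) (parentSeq τ'.1) := by
  unfold parentSeq
  rw [seqLE_lastSeq hG]
  exact or_congr_right (exists_cons_suffix_iff hG τ τ'.1)

theorem infoLE_iff_exists (hG : G.PerfectRecall) (j j' : G.InfoSet i) :
    InfoLE j j' ↔ j = j' ∨ ∃ a : G.Act j, SeqLE (some ⟨j, a⟩) (parentSeq j') := by
  unfold parentSeq
  simp only [seqLE_lastSeq hG]
  constructor
  · rintro ⟨h, hh, h', hh', s, hs⟩
    rcases List.eq_nil_or_concat s with rfl | ⟨s, b, rfl⟩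
    · left
      rw [List.nil_append] at hs
      subst hs
      exact Subtype.ext ((mem_nodesOf.mp hh).2.symm.trans (mem_nodesOf.mp hh').2)
    · right
      have hs' : (b :: h) <:+ h' := ⟨s, by simpa using hs⟩
      have hm := mem_nodes_of_suffix hs' (mem_nodes_of_mem_decisionNodes (mem_nodesOf.mp hh').1)
      have hb : b ∈ infoActions j := actions_eq_infoActions hh ▸ (G.mem_actions h b).mpr hm
      exact ⟨⟨b, hb⟩, (exists_cons_suffix_iff hG ⟨j, ⟨b, hb⟩⟩ j').mp ⟨h, hh, h', hh', hs'⟩⟩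
  · rintro (rfl | ⟨a, ha⟩)
    · exact ⟨_, choose_mem_nodesOf j, _, choose_mem_nodesOf j, List.suffix_rfl⟩
    · obtain ⟨h, hh, h', hh', hs⟩ := (exists_cons_suffix_iff hG ⟨j, a⟩ j').mpr ha
      exact ⟨h, hh, h', hh', (List.suffix_cons _ _).trans hs⟩

theorem infoLESeq_iff_exists (hG : G.PerfectRecall) (j : G.InfoSet i) (σ : G.Sequence i) :
    InfoLESeq j σ ↔ ∃ a : G.Act j, SeqLE (some ⟨j, a⟩) σ := by
  cases σ with
  | none => simp [InfoLESeq, SeqLE]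
  | some τ =>
    simp only [InfoLESeq, infoLE_iff_exists hG, seqLE_some_iff hG, exists_or]
    refine or_congr_left ⟨?_, ?_⟩
    · rintro rfl
      exact ⟨τ.2, rfl⟩
    · rintro ⟨a, rfl⟩
      rfl

theorem infoLE_iff (hG : G.PerfectRecall) (j j' : G.InfoSet i) :
    InfoLE j j' ↔ j = j' ∨ InfoLESeq j (parentSeq j') := by
  rw [infoLE_iff_exists hG, infoLESeq_iff_exists hG]

theorem InfoLE.refl (j : G.InfoSet i) : InfoLE j j :=
  ⟨_, choose_mem_nodesOf j, _, choose_mem_nodesOf j, List.suffix_rfl⟩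

theorem infoLESeq_of_seqLE (hG : G.PerfectRecall) {τ : G.NSeq i} {σ : G.Sequence i}
    (h : SeqLE (some τ) σ) : InfoLESeq τ.1 σ :=
  (infoLESeq_iff_exists hG _ _).mpr ⟨τ.2, h⟩

/-- The number of own moves that precede an information set. -/
noncomputable def depth (j : G.InfoSet i) : ℕ := (infoExp j).length

theorem depth_lt_of_lastSeq (hG : G.PerfectRecall) {h : List A} (hm : h ∈ G.nodes)
    {ρ : G.NSeq i} (hρ : G.lastSeq i h hm = some ρ) :
    depth ρ.1 < (G.experience i h).length := by
  induction h with
  | nil => simp [lastSeq] at hρ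
  | cons a t ih =>
    unfold lastSeq at hρ
    unfold experience
    split_ifs at hρ ⊢ with hp
    · have ht := G.mem_decisionNodes_of_cons hm hp
      obtain rfl := Option.some.inj hρ
      unfold depth
      rw [← experience_eq_infoExp hG (mem_nodesOf.mpr ⟨ht, rfl⟩)]
      simp
    · exact ih _ hρ

theorem depth_lt (hG : G.PerfectRecall) {j : G.InfoSet i} {ρ : G.NSeq i}
    (hρ : parentSeq j = some ρ) : depth ρ.1 < depth j :=
  depth_lt_of_lastSeq hG _ hρ

/-- Induction along the tree of the information sets of a player. -/
theorem infoSet_induction (hG : G.PerfectRecall) {P : G.InfoSet i → Prop}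
    (step : ∀ j, (∀ ρ, parentSeq j = some ρ → P ρ.1) → P j) (j : G.InfoSet i) : P j := by
  induction hd : depth j using Nat.strong_induction_on generalizing j with
  | _ d ih => exact step j fun ρ hρ => ih _ (hd ▸ depth_lt hG hρ) _ rfl

theorem depth_lt_of_infoLESeq (hG : G.PerfectRecall) {j j' : G.InfoSet i}
    (h : InfoLESeq j (parentSeq j')) : depth j < depth j' := by
  induction j' using infoSet_induction hG with
  | step j' ih =>
    cases hp : parentSeq j' with
    | none => rw [hp] at h; exact h.elim
    | some ρ =>
      rw [hp] at h
      rcases (infoLE_iff hG _ _).mp h with rfl | h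
      · exact depth_lt hG hp
      · exact (ih ρ hp h).trans (depth_lt hG hp)

theorem not_infoLESeq_parentSeq (hG : G.PerfectRecall) (j : G.InfoSet i) :
    ¬ InfoLESeq j (parentSeq j) :=
  fun h => (depth_lt_of_infoLESeq hG h).false

theorem not_seqLE_parentSeq (hG : G.PerfectRecall) (τ : G.NSeq i) :
    ¬ SeqLE (some τ) (parentSeq τ.1) :=
  fun h => not_infoLESeq_parentSeq hG _ (infoLESeq_of_seqLE hG h)

theorem depth_le_of_infoLE (hG : G.PerfectRecall) {j j' : G.InfoSet i} (h : InfoLE j j') :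
    depth j ≤ depth j' := by
  rcases (infoLE_iff hG _ _).mp h with rfl | h
  · rfl
  · exact (depth_lt_of_infoLESeq hG h).le

theorem SeqLE.refl (σ : G.Sequence i) : SeqLE σ σ := by
  cases σ with
  | none => trivial
  | some τ => exact Or.inl rfl

/-- Every nonempty sequence is the last sequence of some node, and the root is not one of these
nodes. -/
theorem card_nseq_lt_card_nodes (i : Fin n) : Fintype.card (G.NSeq i) + 1 ≤ G.nodes.card := by
  let f : G.NSeq i → List A := fun τ => τ.2.1 :: (Finset.mem_image.mp τ.1.2).choose
  have hf : Function.Injective f := by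
    intro τ τ' h
    obtain ⟨h1, h2⟩ := List.cons.inj h
    apply code_injective
    refine Prod.ext ?_ h1
    have e1 := (mem_nodesOf.mp (choose_mem_nodesOf τ.1)).2
    have e2 := (mem_nodesOf.mp (choose_mem_nodesOf τ'.1)).2
    change τ.1.1 = τ'.1.1
    rw [← e1, ← e2, h2]
  have hm : ∀ τ, f τ ∈ G.nodes.erase [] := fun τ => by
    refine Finset.mem_erase.mpr ⟨List.cons_ne_nil _ _, ?_⟩
    rw [← G.mem_actions, actions_eq_infoActions (choose_mem_nodesOf τ.1)]
    exact τ.2.2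
  have := Finset.card_le_card_of_injOn (s := Finset.univ) f (fun τ _ => hm τ) hf.injOn
  rw [Finset.card_erase_of_mem G.root_mem, Finset.card_univ] at this
  have := Finset.card_pos.mpr ⟨_, G.root_mem⟩
  omega

/-! ### Flows on the game tree and the range of the utilities -/

/-- A function on the nodes whose value at each non-terminal node is the sum of its values at the
children has total mass on the terminal nodes equal to its value at the root. -/
theorem sum_terminals_of_flow (f : List A → ℝ)
    (hf : ∀ h ∈ G.nodes, (G.actions h).Nonempty → f h = ∑ a ∈ G.actions h, f (a :: h)) :
    ∑ z : G.Terminal, f z.1 = f [] := by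
  have h1 : ∑ z : G.Terminal, f z.1 = ∑ h ∈ G.nodes, if G.actions h = ∅ then f h else 0 := by
    rw [Finset.sum_coe_sort G.terminals f, terminals, Finset.sum_filter]
  have h2 : ∑ h ∈ G.nodes, f h = (∑ h ∈ G.nodes, if G.actions h = ∅ then f h else 0) +
      ∑ h ∈ G.nodes, ∑ a ∈ G.actions h, f (a :: h) := by
    rw [← Finset.sum_add_distrib]
    refine Finset.sum_congr rfl fun h hh => ?_
    split_ifs with he
    · simp [he]
    · rw [zero_add, hf h hh (Finset.nonempty_iff_ne_empty.mpr he)]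
  have h3 : ∑ h ∈ G.nodes, ∑ a ∈ G.actions h, f (a :: h) = ∑ h ∈ G.nodes.erase [], f h := by
    rw [Finset.sum_sigma']
    refine Finset.sum_bij (fun p _ => p.2 :: p.1) ?_ ?_ ?_ ?_
    · rintro ⟨h, a⟩ hp
      have := (Finset.mem_sigma.mp hp).2
      exact Finset.mem_erase.mpr ⟨List.cons_ne_nil _ _, (G.mem_actions h a).mp this⟩
    · rintro ⟨h, a⟩ _ ⟨h', a'⟩ _ he
      obtain ⟨rfl, rfl⟩ := List.cons.inj he
      rfl
    · intro h hh
      obtain ⟨h0, hm⟩ := Finset.mem_erase.mp hh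
      cases h with
      | nil => exact absurd rfl h0
      | cons a t =>
        exact ⟨⟨t, a⟩, Finset.mem_sigma.mpr ⟨G.parent_mem a t hm, (G.mem_actions t a).mpr hm⟩, rfl⟩
    · intro _ _
      rfl
  have h4 := Finset.add_sum_erase G.nodes f G.root_mem
  linarith

theorem chanceReach_nonneg {h : List A} (hm : h ∈ G.nodes) : 0 ≤ G.chanceReach h := by
  induction h with
  | nil => simp [chanceReach]
  | cons a t ih =>
    have ht := G.parent_mem a t hm
    unfold chanceReach
    split_ifs with hp
    · exact mul_nonneg (G.chance_nonneg t ht hp a ((G.mem_actions t a).mpr hm)) (ih ht)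
    · exact ih ht

/-- If every player `k` follows a sequence-form strategy `x k`, the probabilities of the terminal
nodes add up to one. -/
theorem sum_reach_eq_one (hG : G.PerfectRecall) (x : (k : Fin n) → G.Sequence k → ℝ)
    (hx : ∀ k, x k ∈ G.seqPolytope k) :
    ∑ z : G.Terminal, G.chanceReach z.1 * ∏ k, x k (G.termSeq k z) = 1 := by
  let f : List A → ℝ := fun h =>
    if hm : h ∈ G.nodes then G.chanceReach h * ∏ k, x k (G.lastSeq k h hm) else 0
  have hroot : f [] = 1 := by
    have : f [] = G.chanceReach [] * ∏ k, x k (G.lastSeq k [] G.root_mem) := dif_pos G.root_mem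
    rw [this]
    simp [chanceReach, lastSeq, (hx _).2.1]
  rw [← hroot, ← sum_terminals_of_flow (G := G) f]
  · refine Finset.sum_congr rfl fun z _ => ?_
    have : f z.1 = G.chanceReach z.1 * ∏ k, x k (G.lastSeq k z.1 (Finset.mem_filter.mp z.2).1) :=
      dif_pos _
    exact this.symm
  intro h hm ha
  have hfh : f h = G.chanceReach h * ∏ k, x k (G.lastSeq k h hm) := dif_pos hm
  have hfa : ∀ a ∈ G.actions h, ∃ hma : a :: h ∈ G.nodes,
      f (a :: h) = G.chanceReach (a :: h) * ∏ k, x k (G.lastSeq k (a :: h) hma) := fun a haa =>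
    ⟨(G.mem_actions h a).mp haa, dif_pos _⟩
  cases hp : G.player h with
  | none =>
    have : ∀ a ∈ G.actions h, f (a :: h) = G.chance h a * f h := by
      intro a haa
      obtain ⟨hma, e⟩ := hfa a haa
      rw [e, hfh, ← mul_assoc]
      simp [chanceReach, lastSeq, hp]
    rw [Finset.sum_congr rfl this, ← Finset.sum_mul, G.chance_sum h hm ha hp, one_mul]
  | some i =>
    have hd : h ∈ G.decisionNodes i := Finset.mem_filter.mpr ⟨hm, ha, hp⟩
    let j : G.InfoSet i := ⟨G.info h, Finset.mem_image_of_mem _ hd⟩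
    have hj : h ∈ nodesOf j := mem_nodesOf.mpr ⟨hd, rfl⟩
    rw [actions_eq_infoActions hj, ← Finset.sum_coe_sort]
    have : ∀ a : G.Act j, f (a.1 :: h) =
        G.chanceReach h * ((∏ k ∈ Finset.univ.erase i, x k (G.lastSeq k h hm)) *
          x i (some ⟨j, a⟩)) := by
      intro a
      obtain ⟨hma, e⟩ := hfa a.1 (by rw [actions_eq_infoActions hj]; exact a.2)
      rw [e, ← Finset.prod_erase_mul _ _ (Finset.mem_univ i)]
      congr 1
      · simp [chanceReach, hp]
      · congr 1
        · refine Finset.prod_congr rfl fun k hk => ?_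
          have : i ≠ k := (Finset.ne_of_mem_erase hk).symm
          simp [lastSeq, hp, this]
        · simp only [lastSeq, hp, dif_pos]
          rfl
    rw [Finset.sum_congr rfl fun a _ => this a, ← Finset.mul_sum, ← Finset.mul_sum,
      ← (hx i).2.2 j, hfh, ← Finset.prod_erase_mul _ _ (Finset.mem_univ i),
      lastSeq_eq_parentSeq hG hj]

theorem utility_apply (i : Fin n) (p : G.Profile) (x : G.Sequence i → ℝ) :
    utility i p x = ∑ z : G.Terminal, (G.payoff i z.1 * G.chanceReach z.1 *
      ∏ k ∈ Finset.univ.erase i, (p k).1 (G.termSeq k z)) * x (G.termSeq i z) := by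
  simp [utility, LinearMap.sum_apply]

theorem payoff_le_iSup (i : Fin n) (z : G.Terminal) :
    G.payoff i z.1 ≤ ⨆ x : Fin n × G.Terminal, G.payoff x.1 x.2.1 :=
  le_ciSup (f := fun x : Fin n × G.Terminal => G.payoff x.1 x.2.1)
    (Set.finite_range _).bddAbove (i, z)

theorem iInf_le_payoff (i : Fin n) (z : G.Terminal) :
    ⨅ x : Fin n × G.Terminal, G.payoff x.1 x.2.1 ≤ G.payoff i z.1 :=
  ciInf_le (f := fun x : Fin n × G.Terminal => G.payoff x.1 x.2.1)
    (Set.finite_range _).bddBelow (i, z)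

/-- The utility of a sequence-form strategy is an average of payoffs. -/
theorem utility_mem_Icc (hG : G.PerfectRecall) (p : G.Profile) {x : G.Sequence i → ℝ}
    (hx : x ∈ G.seqPolytope i) :
    utility i p x ∈ Set.Icc (⨅ y : Fin n × G.Terminal, G.payoff y.1 y.2.1)
      (⨆ y : Fin n × G.Terminal, G.payoff y.1 y.2.1) := by
  let X : (k : Fin n) → G.Sequence k → ℝ := Function.update (fun k => (p k).1) i x
  have hX : ∀ k, X k ∈ G.seqPolytope k := by
    intro k
    by_cases hk : k = i
    · subst hk
      simpa [X] using hx
    · simpa [X, hk] using (p k).2.1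
  set w : G.Terminal → ℝ := fun z => G.chanceReach z.1 * ∏ k, X k (G.termSeq k z) with hw
  have hw0 : ∀ z, 0 ≤ w z := fun z =>
    mul_nonneg (chanceReach_nonneg (Finset.mem_filter.mp z.2).1)
      (Finset.prod_nonneg fun k _ => (hX k).1 _)
  have hw1 : ∑ z, w z = 1 := sum_reach_eq_one hG X hX
  have hu : utility i p x = ∑ z, w z * G.payoff i z.1 := by
    rw [utility_apply]
    refine Finset.sum_congr rfl fun z _ => ?_
    have h1 : ∏ k, X k (G.termSeq k z) =
        (∏ k ∈ Finset.univ.erase i, (p k).1 (G.termSeq k z)) * x (G.termSeq i z) := by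
      rw [← Finset.prod_erase_mul _ _ (Finset.mem_univ i)]
      congr 1
      · refine Finset.prod_congr rfl fun k hk => ?_
        simp [X, Finset.ne_of_mem_erase hk]
      · simp [X]
    simp only [hw, h1]
    ring
  rw [hu]
  constructor
  · calc _ = ∑ z, w z * ⨅ y : Fin n × G.Terminal, G.payoff y.1 y.2.1 := by
          rw [← Finset.sum_mul, hw1, one_mul]
      _ ≤ _ := Finset.sum_le_sum fun z _ =>
          mul_le_mul_of_nonneg_left (iInf_le_payoff i z) (hw0 z)
  · calc _ ≤ ∑ z, w z * ⨆ y : Fin n × G.Terminal, G.payoff y.1 y.2.1 :=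
          Finset.sum_le_sum fun z _ => mul_le_mul_of_nonneg_left (payoff_le_iSup i z) (hw0 z)
      _ = _ := by rw [← Finset.sum_mul, hw1, one_mul]

theorem abs_utility_sub_le (hG : G.PerfectRecall) (p : G.Profile) {x y : G.Sequence i → ℝ}
    (hx : x ∈ G.seqPolytope i) (hy : y ∈ G.seqPolytope i) :
    |utility i p x - utility i p y| ≤ G.payoffRange := by
  have h1 := utility_mem_Icc hG p hx
  have h2 := utility_mem_Icc hG p hy
  unfold payoffRange
  rw [abs_le]
  constructor <;> linarith [h1.1, h1.2, h2.1, h2.2]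

theorem payoffRange_nonneg (G : ExtGame n A K) : 0 ≤ G.payoffRange := by
  unfold payoffRange
  rcases isEmpty_or_nonempty (Fin n × G.Terminal) with he | ⟨⟨x⟩⟩
  · simp
  · have h1 := payoff_le_iSup (G := G) x.1 x.2
    have h2 := iInf_le_payoff (G := G) x.1 x.2
    linarith

/-! ### Continuation strategies and trigger deviations -/

theorem entry_some_of_infoLE {j j' : G.InfoSet i} (h : InfoLE j j') (y : SubSeq j → ℝ)
    (a : G.Act j') : entry y (some ⟨j', a⟩) = y ⟨⟨j', a⟩, h⟩ :=
  dif_pos h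

theorem entry_coe {j : G.InfoSet i} (y : SubSeq j → ℝ) (τ : SubSeq j) :
    entry y (some τ.1) = y τ :=
  dif_pos τ.2

theorem entry_nonneg {j : G.InfoSet i} {y : SubSeq j → ℝ} (hy : ∀ τ, 0 ≤ y τ)
    (σ : G.Sequence i) : 0 ≤ entry y σ := by
  cases σ with
  | none => exact le_rfl
  | some τ =>
    simp only [entry]
    split_ifs
    · exact hy _
    · exact le_rfl

theorem trigMap_apply (τ : G.NSeq i) (y : SubSeq τ.1 → ℝ) (x : G.Sequence i → ℝ)
    (σ : G.Sequence i) :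
    trigMap τ y x σ = (if SeqLE (some τ) σ then 0 else x σ) +
      (if InfoLESeq τ.1 σ then entry y σ * x (some τ) else 0) := by
  have hM : ∀ c, trigMatrix τ y σ c =
      (if σ = c then (if SeqLE (some τ) σ then 0 else 1) else 0) +
        (if c = some τ then (if InfoLESeq τ.1 σ then entry y σ else 0) else 0) := by
    intro c
    simp only [trigMatrix, Matrix.of_apply]
    by_cases h1 : σ = c
    · subst h1
      by_cases h2 : SeqLE (some τ) σ
      · simp [h2, ite_and]
      · have h3 : σ ≠ some τ := fun h => h2 (h ▸ SeqLE.refl _)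
        simp [h2, h3]
    · simp [h1, ite_and]
  simp only [trigMap, Matrix.mulVecLin_apply, Matrix.mulVec, dotProduct, hM, add_mul,
    Finset.sum_add_distrib, ite_mul, zero_mul, one_mul, Finset.sum_ite_eq, Finset.sum_ite_eq',
    Finset.mem_univ, if_true]

/-- Trigger deviations map sequence-form strategies to sequence-form strategies. -/
theorem trigMap_mem_seqPolytope (hG : G.PerfectRecall) (τ : G.NSeq i) {y : SubSeq τ.1 → ℝ}
    (hy : y ∈ subPolytope τ.1) {x : G.Sequence i → ℝ} (hx : x ∈ G.seqPolytope i) :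
    trigMap τ y x ∈ G.seqPolytope i := by
  refine ⟨fun σ => ?_, ?_, fun j => ?_⟩
  · rw [trigMap_apply]
    refine add_nonneg ?_ ?_
    · split_ifs
      · exact le_rfl
      · exact hx.1 σ
    · split_ifs
      · exact mul_nonneg (entry_nonneg hy.1 σ) (hx.1 _)
      · exact le_rfl
  · rw [trigMap_apply, hx.2.1]
    simp [SeqLE, InfoLESeq]
  · simp only [trigMap_apply, seqLE_some_iff hG]
    have hI : ∀ a : G.Act j, InfoLESeq τ.1 (some ⟨j, a⟩) ↔
        τ.1 = j ∨ InfoLESeq τ.1 (parentSeq j) := fun a => infoLE_iff hG _ _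
    simp only [hI]
    by_cases h1 : τ.1 = j
    · obtain ⟨j', a₀⟩ := τ
      dsimp only at h1
      subst h1
      have h2 := not_seqLE_parentSeq hG (⟨j', a₀⟩ : G.NSeq i)
      have h3 := not_infoLESeq_parentSeq hG j'
      simp only [h2, h3, or_false, if_false, if_true, add_zero]
      rw [Finset.sum_add_distrib, ← Finset.sum_mul, hy.2.1, one_mul, hx.2.2 j',
        ← Finset.sum_erase_add _ _ (Finset.mem_univ a₀)]
      congr 1
      have h4 : ∀ a : G.Act j', ((⟨j', a₀⟩ : G.NSeq i) = ⟨j', a⟩) ↔ a₀ = a := fun a => by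
        simp
      simp only [h4]
      rw [← Finset.sum_erase_add _ _ (Finset.mem_univ a₀)]
      simp only [if_true, add_zero]
      refine Finset.sum_congr rfl fun a ha => ?_
      rw [if_neg (Finset.ne_of_mem_erase ha).symm]
    · have h4 : ∀ a : G.Act j, τ ≠ ⟨j, a⟩ := fun a h => h1 (by rw [h])
      simp only [h1, h4, false_or]
      rw [Finset.sum_add_distrib]
      congr 1
      · split_ifs
        · simp
        · exact hx.2.2 j
      · split_ifs with h3
        · rw [← Finset.sum_mul, hy.2.2 j ((infoLE_iff hG _ _).mpr (Or.inr h3)) (Ne.symm h1)]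
        · simp

/-! ### Sequence-form representations of behavioral strategies -/

/-- The mass that a vector on the sequences below `j` sends into the information set `j'`: the entry
of the parent sequence, and one at `j` itself. -/
noncomputable def inflow {j : G.InfoSet i} (y : SubSeq j → ℝ) (j' : G.InfoSet i) : ℝ :=
  if j' = j then 1 else entry y (parentSeq j')

/-- `b` prescribes a probability distribution at each information set of the subtree of `j`. -/
def IsBehavior {j : G.InfoSet i} (b : SubSeq j → ℝ) : Prop :=
  (∀ τ, 0 ≤ b τ) ∧ ∀ (j' : G.InfoSet i) (h : InfoLE j j'), ∑ a, b ⟨⟨j', a⟩, h⟩ = 1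

theorem inflow_eq_sum {j : G.InfoSet i} {y : SubSeq j → ℝ} (hy : y ∈ subPolytope j)
    {j' : G.InfoSet i} (h : InfoLE j j') : inflow y j' = ∑ a, y ⟨⟨j', a⟩, h⟩ := by
  unfold inflow
  have e : ∀ a, y ⟨⟨j', a⟩, h⟩ = entry y (some ⟨j', a⟩) := fun a =>
    (entry_some_of_infoLE h y a).symm
  simp only [e]
  split_ifs with hj
  · subst hj
    exact hy.2.1.symm
  · exact hy.2.2 j' h hj

theorem exists_parent {j j' : G.InfoSet i} (hG : G.PerfectRecall) (h : InfoLE j j')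
    (hj : j' ≠ j) : ∃ π : SubSeq j, parentSeq j' = some π.1 := by
  have h1 := ((infoLE_iff hG _ _).mp h).resolve_left (Ne.symm hj)
  cases hp : parentSeq j' with
  | none => rw [hp] at h1; exact h1.elim
  | some π => rw [hp] at h1; exact ⟨⟨π, h1⟩, rfl⟩

theorem subSeq_induction (hG : G.PerfectRecall) {j : G.InfoSet i} {P : SubSeq j → Prop}
    (step : ∀ τ, (∀ π : SubSeq j, parentSeq τ.1.1 = some π.1 → P π) → P τ) (τ : SubSeq j) :
    P τ := by
  induction hd : depth τ.1.1 using Nat.strong_induction_on generalizing τ with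
  | _ d ih => exact step τ fun π hπ => ih _ (hd ▸ depth_lt hG hπ) _ rfl

/-- The sequences below `j` that precede `σ`. -/
noncomputable def anc (j : G.InfoSet i) (σ : G.Sequence i) : Finset (SubSeq j) :=
  Finset.univ.filter fun ρ => SeqLE (some ρ.1) σ

theorem mem_anc {j : G.InfoSet i} {σ : G.Sequence i} {ρ : SubSeq j} :
    ρ ∈ anc j σ ↔ SeqLE (some ρ.1) σ := by
  simp [anc]

theorem anc_some (hG : G.PerfectRecall) {j : G.InfoSet i} (τ : SubSeq j) :
    anc j (some τ.1) = insert τ (anc j (parentSeq τ.1.1)) := by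
  ext ρ
  rw [Finset.mem_insert, mem_anc, mem_anc, seqLE_some_iff hG, Subtype.ext_iff]

theorem notMem_anc_parentSeq (hG : G.PerfectRecall) {j : G.InfoSet i} (τ : SubSeq j) :
    τ ∉ anc j (parentSeq τ.1.1) :=
  fun h => not_seqLE_parentSeq hG _ (mem_anc.mp h)

theorem anc_parentSeq_self (hG : G.PerfectRecall) (j : G.InfoSet i) :
    anc j (parentSeq j) = ∅ := by
  refine Finset.eq_empty_of_forall_notMem fun ρ hρ => ?_
  have h1 := depth_lt_of_infoLESeq hG (infoLESeq_of_seqLE hG (mem_anc.mp hρ))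
  exact absurd (depth_le_of_infoLE hG ρ.2) (not_le.mpr h1)

theorem toSeqForm_eq {j : G.InfoSet i} (b : SubSeq j → ℝ) (τ : SubSeq j) :
    toSeqForm b τ = ∏ ρ ∈ anc j (some τ.1), b ρ :=
  rfl

theorem inflow_toSeqForm (hG : G.PerfectRecall) {j j' : G.InfoSet i} (h : InfoLE j j')
    (b : SubSeq j → ℝ) : inflow (toSeqForm b) j' = ∏ ρ ∈ anc j (parentSeq j'), b ρ := by
  unfold inflow
  split_ifs with hj
  · subst hj
    rw [anc_parentSeq_self hG, Finset.prod_empty]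
  · obtain ⟨π, hπ⟩ := exists_parent hG h hj
    rw [hπ, entry_coe, toSeqForm_eq]

theorem toSeqForm_rec (hG : G.PerfectRecall) {j : G.InfoSet i} (b : SubSeq j → ℝ)
    (τ : SubSeq j) : toSeqForm b τ = b τ * inflow (toSeqForm b) τ.1.1 := by
  rw [toSeqForm_eq, anc_some hG, Finset.prod_insert (notMem_anc_parentSeq hG τ),
    inflow_toSeqForm hG τ.2]

theorem toSeqForm_mem_subPolytope (hG : G.PerfectRecall) {j : G.InfoSet i} {b : SubSeq j → ℝ}
    (hb : IsBehavior b) : toSeqForm b ∈ subPolytope j := by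
  have key : ∀ j' (h : InfoLE j j'),
      ∑ a, entry (toSeqForm b) (some ⟨j', a⟩) = inflow (toSeqForm b) j' := by
    intro j' h
    simp only [entry_some_of_infoLE h]
    rw [Finset.sum_congr rfl fun a _ => toSeqForm_rec hG b ⟨⟨j', a⟩, h⟩]
    dsimp only
    rw [← Finset.sum_mul, hb.2 j' h, one_mul]
  refine ⟨fun τ => Finset.prod_nonneg fun ρ _ => hb.1 ρ, ?_, fun j' h hj => ?_⟩
  · rw [key j (InfoLE.refl j)]
    exact if_pos rfl
  · rw [key j' h]
    exact (if_neg hj).symm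

/-- Summation over the sequences below `j`, information set by information set. -/
theorem sum_subSeq {j : G.InfoSet i} (f : SubSeq j → ℝ) :
    ∑ τ, f τ = ∑ j' : {j' : G.InfoSet i // InfoLE j j'}, ∑ a : G.Act j'.1, f ⟨⟨j'.1, a⟩, j'.2⟩ := by
  let e : ((j' : {j' : G.InfoSet i // InfoLE j j'}) × G.Act j'.1) ≃ SubSeq j :=
    { toFun := fun p => ⟨⟨p.1.1, p.2⟩, p.1.2⟩
      invFun := fun τ => ⟨⟨τ.1.1, τ.2⟩, τ.1.2⟩
      left_inv := fun _ => rfl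
      right_inv := fun _ => rfl }
  rw [← e.sum_comp, Fintype.sum_sigma]
  rfl

/-! ### Counterfactual regrets -/

/-- The probability with which `b` continues from the sequence `τ` to the sequence `σ`. -/
noncomputable def linkProd {j : G.InfoSet i} (b : SubSeq j → ℝ) (τ : SubSeq j)
    (σ : G.Sequence i) : ℝ :=
  ∏ ρ : SubSeq j with (SeqLE (some τ.1) (some ρ.1) ∧ ρ ≠ τ ∧ SeqLE (some ρ.1) σ), b ρ

theorem cfValue_eq {j : G.InfoSet i} (b : SubSeq j → ℝ) (g : (SubSeq j → ℝ) →ₗ[ℝ] ℝ)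
    (τ : SubSeq j) : cfValue b g τ = ∑ τ' : SubSeq j with SeqLE (some τ.1) (some τ'.1),
      g (Pi.single τ' 1) * linkProd b τ (some τ'.1) :=
  rfl

theorem linkProd_self (hG : G.PerfectRecall) {j : G.InfoSet i} (b : SubSeq j → ℝ)
    (τ : SubSeq j) : linkProd b τ (some τ.1) = 1 := by
  unfold linkProd
  rw [Finset.filter_eq_empty_iff.mpr, Finset.prod_empty]
  rintro ρ - ⟨h1, h2, h3⟩
  have h4 := ((seqLE_some_iff hG _ _).mp h1).resolve_left fun h => h2 (Subtype.ext h.symm)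
  have h5 := ((seqLE_some_iff hG _ _).mp h3).resolve_left fun h => h2 (Subtype.ext h)
  have h6 := depth_lt_of_infoLESeq hG (infoLESeq_of_seqLE hG h4)
  have h7 := depth_lt_of_infoLESeq hG (infoLESeq_of_seqLE hG h5)
  omega

theorem linkProd_some (hG : G.PerfectRecall) {j : G.InfoSet i} (b : SubSeq j → ℝ)
    {τ τ' : SubSeq j} (h : SeqLE (some τ.1) (parentSeq τ'.1.1)) :
    linkProd b τ (some τ'.1) = b τ' * linkProd b τ (parentSeq τ'.1.1) := by
  unfold linkProd
  rw [← Finset.prod_insert]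
  · congr 1
    ext ρ
    simp only [Finset.mem_filter, Finset.mem_univ, true_and, Finset.mem_insert]
    constructor
    · rintro ⟨h1, h2, h3⟩
      rcases (seqLE_some_iff hG _ _).mp h3 with h4 | h4
      · exact Or.inl (Subtype.ext h4)
      · exact Or.inr ⟨h1, h2, h4⟩
    · rintro (rfl | ⟨h1, h2, h3⟩)
      · refine ⟨(seqLE_some_iff hG _ _).mpr (Or.inr h), ?_, SeqLE.refl _⟩
        rintro rfl
        exact not_seqLE_parentSeq hG _ h
      · exact ⟨h1, h2, (seqLE_some_iff hG _ _).mpr (Or.inr h3)⟩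
  · intro hmem
    exact not_seqLE_parentSeq hG _ (Finset.mem_filter.mp hmem).2.2.2

/-- The deviations of `y` from `b` along the chain of the sequences preceding `τ'`, each propagated
to `τ'` with the probabilities prescribed by `b`, telescope. -/
theorem sum_anc_mul_linkProd (hG : G.PerfectRecall) {j : G.InfoSet i} (b y : SubSeq j → ℝ)
    (τ' : SubSeq j) :
    ∑ τ ∈ anc j (some τ'.1), (y τ - inflow y τ.1.1 * b τ) * linkProd b τ (some τ'.1) =
      y τ' - toSeqForm b τ' := by
  induction τ' using subSeq_induction hG with
  | step τ' ih =>
    rw [anc_some hG, Finset.sum_insert (notMem_anc_parentSeq hG τ'), linkProd_self hG,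
      toSeqForm_rec hG b τ']
    have e : ∑ τ ∈ anc j (parentSeq τ'.1.1),
        (y τ - inflow y τ.1.1 * b τ) * linkProd b τ (some τ'.1) =
        b τ' * ∑ τ ∈ anc j (parentSeq τ'.1.1),
          (y τ - inflow y τ.1.1 * b τ) * linkProd b τ (parentSeq τ'.1.1) := by
      rw [Finset.mul_sum]
      refine Finset.sum_congr rfl fun τ hτ => ?_
      rw [linkProd_some hG b (mem_anc.mp hτ)]
      ring
    rw [e]
    by_cases hj : τ'.1.1 = j
    · have e1 : anc j (parentSeq τ'.1.1) = ∅ := by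
        rw [hj]
        exact anc_parentSeq_self hG j
      rw [e1, Finset.sum_empty, inflow, inflow, if_pos hj, if_pos hj]
      ring
    · obtain ⟨π, hπ⟩ := exists_parent hG τ'.2 hj
      have e1 : ∀ z : SubSeq j → ℝ, inflow z τ'.1.1 = z π := fun z => by
        rw [inflow, if_neg hj, hπ, entry_coe]
      rw [e1, e1, hπ, ih π hπ]
      ring

/-- The regret of the behavioral strategy `b` against an arbitrary vector `y`, as the sum over all
sequences of the local deviations of `y` from `b`, weighted by counterfactual values. -/
theorem sum_mul_cfValue (hG : G.PerfectRecall) {j : G.InfoSet i} (b y : SubSeq j → ℝ)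
    (g : (SubSeq j → ℝ) →ₗ[ℝ] ℝ) :
    ∑ τ, (y τ - inflow y τ.1.1 * b τ) * cfValue b g τ = g y - g (toSeqForm b) := by
  simp only [cfValue_eq, Finset.mul_sum, Finset.sum_filter]
  rw [Finset.sum_comm]
  have hg : ∀ z : SubSeq j → ℝ, g z = ∑ τ, z τ * g (Pi.single τ 1) := fun z => by
    conv_lhs => rw [LinearMap.pi_apply_eq_sum_univ g z]
    refine Finset.sum_congr rfl fun τ _ => ?_
    rw [smul_eq_mul]
    congr 2
    ext ρ
    simp [Pi.single_apply, eq_comm]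
  rw [hg y, hg (toSeqForm b), ← Finset.sum_sub_distrib]
  refine Finset.sum_congr rfl fun τ' _ => ?_
  rw [← sub_mul, ← sum_anc_mul_linkProd hG, Finset.sum_mul, anc, Finset.sum_filter]
  refine Finset.sum_congr rfl fun τ _ => ?_
  split_ifs <;> ring

/-- The counterfactual regret for not having chosen the action of `τ` at its information set. -/
noncomputable def cfRegret {j : G.InfoSet i} (b : SubSeq j → ℝ) (g : (SubSeq j → ℝ) →ₗ[ℝ] ℝ)
    (τ : SubSeq j) : ℝ :=
  cfValue b g τ - ∑ a, b (τ.withAct a) * cfValue b g (τ.withAct a)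

/-- The regret of the behavioral strategy `b` against a sequence-form strategy is a combination of
the counterfactual regrets of `b`. -/
theorem sum_mul_cfRegret (hG : G.PerfectRecall) {j : G.InfoSet i} (b : SubSeq j → ℝ)
    {y : SubSeq j → ℝ} (hy : y ∈ subPolytope j) (g : (SubSeq j → ℝ) →ₗ[ℝ] ℝ) :
    ∑ τ, y τ * cfRegret b g τ = g y - g (toSeqForm b) := by
  rw [← sum_mul_cfValue hG, sum_subSeq, sum_subSeq]
  refine Finset.sum_congr rfl fun j' _ => ?_
  have e : ∀ a : G.Act j'.1, cfRegret b g ⟨⟨j'.1, a⟩, j'.2⟩ = cfValue b g ⟨⟨j'.1, a⟩, j'.2⟩ -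
      ∑ a, b ⟨⟨j'.1, a⟩, j'.2⟩ * cfValue b g ⟨⟨j'.1, a⟩, j'.2⟩ := fun a => rfl
  simp only [e, mul_sub, sub_mul, Finset.sum_sub_distrib]
  rw [← Finset.sum_mul, ← inflow_eq_sum hy, Finset.mul_sum]
  congr 1
  exact Finset.sum_congr rfl fun a _ => (mul_assoc _ _ _).symm

theorem act_unique (hG : G.PerfectRecall) {j : G.InfoSet i} {a a' : G.Act j}
    {σ : G.Sequence i} (h : SeqLE (some ⟨j, a⟩) σ) (h' : SeqLE (some ⟨j, a'⟩) σ) : a = a' := by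
  have aux : ∀ j₁ : G.InfoSet i, SeqLE (some ⟨j, a⟩) (parentSeq j₁) →
      SeqLE (some ⟨j, a'⟩) (parentSeq j₁) → a = a' := by
    intro j₁
    induction j₁ using infoSet_induction hG with
    | step j₁ ih =>
      cases hp : parentSeq j₁ with
      | none => exact fun h => h.elim
      | some ρ =>
        intro h h'
        rcases (seqLE_some_iff hG _ _).mp h with h1 | h1 <;>
          rcases (seqLE_some_iff hG _ _).mp h' with h2 | h2
        · simpa using h1.trans h2.symm
        · subst h1; exact absurd h2 (not_seqLE_parentSeq hG (⟨j, a'⟩ : G.NSeq i))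
        · subst h2; exact absurd h1 (not_seqLE_parentSeq hG (⟨j, a⟩ : G.NSeq i))
        · exact ih ρ hp h1 h2
  cases σ with
  | none => exact h.elim
  | some ρ =>
    rcases (seqLE_some_iff hG _ _).mp h with h1 | h1 <;>
      rcases (seqLE_some_iff hG _ _).mp h' with h2 | h2
    · simpa using h1.trans h2.symm
    · subst h1; exact absurd h2 (not_seqLE_parentSeq hG (⟨j, a'⟩ : G.NSeq i))
    · subst h2; exact absurd h1 (not_seqLE_parentSeq hG (⟨j, a⟩ : G.NSeq i))
    · exact aux _ h1 h2

/-- If the utilities of two continuation strategies never differ by more than `D`, then no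
counterfactual regret exceeds `D`. -/
theorem abs_cfRegret_le (hG : G.PerfectRecall) {j : G.InfoSet i} {b : SubSeq j → ℝ}
    (hb : IsBehavior b) {g : (SubSeq j → ℝ) →ₗ[ℝ] ℝ} {D : ℝ}
    (hg : ∀ y ∈ subPolytope j, ∀ y' ∈ subPolytope j, |g y - g y'| ≤ D) (τ₀ : SubSeq j) :
    |cfRegret b g τ₀| ≤ D := by
  obtain ⟨⟨j₀, a₀⟩, h₀⟩ := τ₀
  change InfoLE j j₀ at h₀
  -- `b₂` plays towards `j₀` and follows `b` from there on; `b₁` moreover chooses `a₀` at `j₀`, so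
  -- that the utilities of the two differ by the counterfactual regret.
  let b₂ : SubSeq j → ℝ := fun ρ =>
    if InfoLESeq ρ.1.1 (parentSeq j₀) then
      (if SeqLE (some ρ.1) (parentSeq j₀) then 1 else 0) else b ρ
  let b₁ : SubSeq j → ℝ := fun ρ =>
    if ρ.1.1 = j₀ then (if ρ = ⟨⟨j₀, a₀⟩, h₀⟩ then 1 else 0) else b₂ ρ
  have hb₂ : IsBehavior b₂ := by
    refine ⟨fun ρ => ?_, fun j' h => ?_⟩
    · simp only [b₂]
      split_ifs
      · exact zero_le_one
      · exact le_rfl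
      · exact hb.1 ρ
    · simp only [b₂]
      split_ifs with h1
      · obtain ⟨a, ha⟩ := (infoLESeq_iff_exists hG _ _).mp h1
        rw [Finset.sum_eq_single a, if_pos ha]
        · exact fun a' _ hne => if_neg fun h' => hne (act_unique hG h' ha)
        · exact fun h => absurd (Finset.mem_univ a) h
      · exact hb.2 j' h
  have hb₁ : IsBehavior b₁ := by
    refine ⟨fun ρ => ?_, fun j' h => ?_⟩
    · simp only [b₁]
      split_ifs
      · exact zero_le_one
      · exact le_rfl
      · exact hb₂.1 ρ
    · simp only [b₁]
      split_ifs with h1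
      · subst h1
        rw [Finset.sum_eq_single a₀, if_pos rfl]
        · exact fun a' _ hne => if_neg (by simpa using hne)
        · exact fun h => absurd (Finset.mem_univ _) h
      · exact hb₂.2 j' h
  have hc : ∀ a : G.Act j₀, cfValue b₂ g ⟨⟨j₀, a⟩, h₀⟩ = cfValue b g ⟨⟨j₀, a⟩, h₀⟩ := by
    intro a
    rw [cfValue_eq, cfValue_eq]
    refine Finset.sum_congr rfl fun τ' _ => ?_
    congr 1
    refine Finset.prod_congr rfl fun ρ hρ => if_neg fun h1 => ?_
    have h2 : InfoLE j₀ ρ.1.1 := infoLESeq_of_seqLE hG (Finset.mem_filter.mp hρ).2.1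
    exact absurd (depth_le_of_infoLE hG h2) (not_le.mpr (depth_lt_of_infoLESeq hG h1))
  have hin : inflow (toSeqForm b₁) j₀ = 1 := by
    rw [inflow_toSeqForm hG h₀]
    refine Finset.prod_eq_one fun ρ hρ => ?_
    have h1 := mem_anc.mp hρ
    have h2 := infoLESeq_of_seqLE hG h1
    have h3 : ρ.1.1 ≠ j₀ := fun h => not_infoLESeq_parentSeq hG j₀ (h ▸ h2)
    simp only [b₁, b₂, if_neg h3, if_pos h1, if_pos h2]
  have hb₂₀ : ∀ a : G.Act j₀, b₂ ⟨⟨j₀, a⟩, h₀⟩ = b ⟨⟨j₀, a⟩, h₀⟩ := fun a =>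
    if_neg (not_infoLESeq_parentSeq hG j₀)
  have hdiff : g (toSeqForm b₁) - g (toSeqForm b₂) = cfRegret b g ⟨⟨j₀, a₀⟩, h₀⟩ := by
    rw [← sum_mul_cfValue hG, sum_subSeq, Finset.sum_eq_single ⟨j₀, h₀⟩]
    · have e : ∀ a : G.Act j₀, (toSeqForm b₁ ⟨⟨j₀, a⟩, h₀⟩ - inflow (toSeqForm b₁) j₀ *
          b₂ ⟨⟨j₀, a⟩, h₀⟩) * cfValue b₂ g ⟨⟨j₀, a⟩, h₀⟩ =
          (if a = a₀ then cfValue b g ⟨⟨j₀, a⟩, h₀⟩ else 0) -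
            b ⟨⟨j₀, a⟩, h₀⟩ * cfValue b g ⟨⟨j₀, a⟩, h₀⟩ := by
        intro a
        have e1 : b₁ ⟨⟨j₀, a⟩, h₀⟩ = if a = a₀ then 1 else 0 := by
          simp [b₁]
        rw [toSeqForm_rec hG, hin, hc, hb₂₀, e1]
        split_ifs <;> ring
      rw [Finset.sum_congr rfl fun a _ => e a, Finset.sum_sub_distrib, Finset.sum_ite_eq',
        if_pos (Finset.mem_univ _)]
      rfl
    · intro j' _ hne
      have h1 : j'.1 ≠ j₀ := fun h => hne (Subtype.ext h)
      refine Finset.sum_eq_zero fun a _ => ?_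
      have e1 : b₁ ⟨⟨j'.1, a⟩, j'.2⟩ = b₂ ⟨⟨j'.1, a⟩, j'.2⟩ := if_neg h1
      rw [toSeqForm_rec hG, e1]
      ring
    · exact fun h => absurd (Finset.mem_univ _) h
  rw [← hdiff]
  exact hg _ (toSeqForm_mem_subPolytope hG hb₁) _ (toSeqForm_mem_subPolytope hG hb₂)

end ExtGame

/-! ### Regret matching -/

section RegretMatching

variable {ι : Type u} [Fintype ι]

theorem rmStrategy_nonneg (R : ι → ℝ) (a : ι) : 0 ≤ rmStrategy R a := by
  unfold rmStrategy
  split_ifs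
  · positivity
  · exact div_nonneg (le_max_right _ _) (Finset.sum_nonneg fun _ _ => le_max_right _ _)

theorem sum_rmStrategy [Nonempty ι] (R : ι → ℝ) : ∑ a, rmStrategy R a = 1 := by
  unfold rmStrategy
  split_ifs with h
  · simp
  · rw [← Finset.sum_div, div_self h]

theorem sum_rmStrategy_le_one (R : ι → ℝ) : ∑ a, rmStrategy R a ≤ 1 := by
  rcases isEmpty_or_nonempty ι with h | h
  · simp
  · exact (sum_rmStrategy R).le

/-- The instantaneous regrets of regret matching are orthogonal to the positive part of the
cumulative regrets. -/
theorem sum_posPart_mul_regret (R v : ι → ℝ) :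
    ∑ a, max (R a) 0 * (v a - ∑ b, rmStrategy R b * v b) = 0 := by
  by_cases h : ∑ b, max (R b) 0 = 0
  · have h0 := (Finset.sum_eq_zero_iff_of_nonneg fun b _ => le_max_right (R b) 0).mp h
    exact Finset.sum_eq_zero fun a ha => by rw [h0 a ha, zero_mul]
  · simp only [mul_sub, Finset.sum_sub_distrib, ← Finset.sum_mul]
    rw [Finset.mul_sum, sub_eq_zero]
    refine Finset.sum_congr rfl fun a _ => ?_
    rw [rmStrategy, if_neg h]
    field_simp

theorem max_add_sq_le (R r : ℝ) : (max (R + r) 0) ^ 2 ≤ (max R 0 + r) ^ 2 := by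
  rcases le_total (R + r) 0 with h | h
  · rw [max_eq_right h, zero_pow two_ne_zero]
    exact sq_nonneg _
  · rw [max_eq_left h]
    exact pow_le_pow_left₀ h (by linarith [le_max_left R 0]) 2

/-- The potential of regret matching grows by at most the squared norm of the instantaneous regrets,
since the cross term vanishes. -/
theorem sum_posPart_rmUpdate_sq_le (R v : ι → ℝ) :
    ∑ a, (max (rmUpdate R v a) 0) ^ 2 ≤
      ∑ a, (max (R a) 0) ^ 2 + ∑ a, (v a - ∑ b, rmStrategy R b * v b) ^ 2 := by
  have h := sum_posPart_mul_regret R v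
  calc ∑ a, (max (rmUpdate R v a) 0) ^ 2
      ≤ ∑ a, (max (R a) 0 + (v a - ∑ b, rmStrategy R b * v b)) ^ 2 :=
        Finset.sum_le_sum fun a _ => max_add_sq_le _ _
    _ = ∑ a, (max (R a) 0) ^ 2 + ∑ a, (v a - ∑ b, rmStrategy R b * v b) ^ 2 +
        2 * ∑ a, max (R a) 0 * (v a - ∑ b, rmStrategy R b * v b) := by
        rw [Finset.mul_sum, ← Finset.sum_add_distrib, ← Finset.sum_add_distrib]
        exact Finset.sum_congr rfl fun a _ => by ring
    _ = _ := by rw [h, mul_zero, add_zero]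

end RegretMatching

namespace ExtGame

variable {n : ℕ} {A K : Type u} {G : ExtGame n A K} {i : Fin n}

theorem isBehavior_cfrBehavior {j : G.InfoSet i} (R : SubSeq j → ℝ) :
    IsBehavior (cfrBehavior R) :=
  ⟨fun _ => rmStrategy_nonneg _ _, fun j' h =>
    sum_rmStrategy fun a : G.Act j' => R ⟨⟨j', a⟩, h⟩⟩

/-- CFR runs regret matching at each information set, so that the potentials add up. -/
theorem sum_posPart_cfr_sq_le {j : G.InfoSet i} (R : SubSeq j → ℝ)
    (g : (SubSeq j → ℝ) →ₗ[ℝ] ℝ) :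
    ∑ τ, (max (R τ + cfRegret (cfrBehavior R) g τ) 0) ^ 2 ≤
      ∑ τ, (max (R τ) 0) ^ 2 + ∑ τ, (cfRegret (cfrBehavior R) g τ) ^ 2 := by
  rw [sum_subSeq, sum_subSeq, sum_subSeq, ← Finset.sum_add_distrib]
  exact Finset.sum_le_sum fun j' _ =>
    sum_posPart_rmUpdate_sq_le (fun a : G.Act j'.1 => R ⟨⟨j'.1, a⟩, j'.2⟩)
      fun a => cfValue (cfrBehavior R) g ⟨⟨j'.1, a⟩, j'.2⟩

/-! ### Fixed points of convex combinations of trigger deviations -/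

/-- The coordinate `σ` of the equation `x = ∑ τ, λ τ • trigMap τ (y τ) x`, after cancellation of
the part of `x σ` that no trigger affects. -/
def FixedAt (φ : G.TransRep i) (x : G.Sequence i → ℝ) (σ : G.Sequence i) : Prop :=
  (∑ τ : G.NSeq i with SeqLE (some τ) σ, φ.1 τ) * x σ =
    ∑ τ : G.NSeq i with InfoLESeq τ.1 σ, φ.1 τ * entry (φ.2 τ) σ * x (some τ)

/-- `φ` represents a convex combination of trigger deviations (or the zero map, if the player has
no sequences). -/
def IsConvexRep (φ : G.TransRep i) : Prop :=
  (∀ τ, 0 ≤ φ.1 τ) ∧ ∑ τ, φ.1 τ ≤ 1 ∧ ∀ τ, φ.2 τ ∈ subPolytope τ.1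

theorem sum_infoLESeq_some (hG : G.PerfectRecall) {j : G.InfoSet i} (a : G.Act j)
    (f : G.NSeq i → ℝ) :
    ∑ τ : G.NSeq i with InfoLESeq τ.1 (some ⟨j, a⟩), f τ =
      ∑ c, f ⟨j, c⟩ + ∑ τ : G.NSeq i with InfoLESeq τ.1 (parentSeq j), f τ := by
  have h1 : ∑ c, f ⟨j, c⟩ = ∑ τ : G.NSeq i, if τ.1 = j then f τ else 0 := by
    rw [Fintype.sum_sigma, Finset.sum_eq_single j]
    · simp
    · intro j' _ hj
      simp [hj]
    · exact fun h => absurd (Finset.mem_univ j) h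
  rw [h1, Finset.sum_filter, Finset.sum_filter, ← Finset.sum_add_distrib]
  refine Finset.sum_congr rfl fun τ _ => ?_
  have h2 : InfoLESeq τ.1 (some ⟨j, a⟩) ↔ τ.1 = j ∨ InfoLESeq τ.1 (parentSeq j) :=
    infoLE_iff hG _ _
  simp only [h2]
  by_cases h3 : τ.1 = j
  · have h4 : ¬ InfoLESeq τ.1 (parentSeq j) := h3 ▸ not_infoLESeq_parentSeq hG τ.1
    simp [h3, h3 ▸ h4]
  · simp [h3]

theorem sum_seqLE_some (hG : G.PerfectRecall) (ρ : G.NSeq i) (f : G.NSeq i → ℝ) :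
    ∑ τ : G.NSeq i with SeqLE (some τ) (some ρ), f τ =
      f ρ + ∑ τ : G.NSeq i with SeqLE (some τ) (parentSeq ρ.1), f τ := by
  rw [← Finset.sum_insert]
  · congr 1
    ext τ
    simp [seqLE_some_iff hG τ ρ]
  · intro h
    exact not_seqLE_parentSeq hG ρ (Finset.mem_filter.mp h).2

theorem extend_self (F : G.Oracle) (φ : G.TransRep i) (x : G.Sequence i → ℝ) (j : G.InfoSet i)
    (a : G.Act j) : extend F φ x j (some ⟨j, a⟩) = extendEntries F φ x j a := by
  simp [extend]

theorem extend_of_ne (F : G.Oracle) (φ : G.TransRep i) (x : G.Sequence i → ℝ)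
    {j : G.InfoSet i} {τ : G.NSeq i} (h : τ.1 ≠ j) :
    extend F φ x j (some τ) = x (some τ) :=
  dif_neg h

section Extend

variable {φ : G.TransRep i} {x : G.Sequence i → ℝ} {j : G.InfoSet i}

theorem extendVec_nonneg (hφ : IsConvexRep φ) (hx : ∀ σ, 0 ≤ x σ) (a : G.Act j) :
    0 ≤ extendVec φ x j a :=
  Finset.sum_nonneg fun τ _ =>
    mul_nonneg (mul_nonneg (hφ.1 τ) (entry_nonneg (hφ.2.2 τ).1 _)) (hx _)

theorem sum_extendVec (hG : G.PerfectRecall) (hφ : IsConvexRep φ)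
    (hp : FixedAt φ x (parentSeq j)) :
    ∑ a, extendVec φ x j a =
      (∑ τ : G.NSeq i with SeqLE (some τ) (parentSeq j), φ.1 τ) * x (parentSeq j) := by
  rw [hp]
  unfold extendVec
  rw [Finset.sum_comm]
  refine Finset.sum_congr rfl fun τ hτ => ?_
  have h1 := (Finset.mem_filter.mp hτ).2
  have h2 : j ≠ τ.1 := fun h => not_infoLESeq_parentSeq hG τ.1 (h ▸ h1)
  rw [(hφ.2.2 τ).2.2 j ((infoLE_iff hG _ _).mpr (Or.inr h1)) h2, Finset.mul_sum,
    Finset.sum_mul]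

theorem sum_seqLE_le_one (hφ : IsConvexRep φ) (σ : G.Sequence i) :
    ∑ τ : G.NSeq i with SeqLE (some τ) σ, φ.1 τ ≤ 1 :=
  (Finset.sum_le_sum_of_subset_of_nonneg (Finset.filter_subset _ _)
    fun τ _ _ => hφ.1 τ).trans hφ.2.1

theorem extendMatrix_nonneg (hφ : IsConvexRep φ) (hx : ∀ σ, 0 ≤ x σ) (r c : G.Act j) :
    0 ≤ extendMatrix φ x j r c := by
  simp only [extendMatrix, Matrix.of_apply]
  refine add_nonneg (extendVec_nonneg hφ hx r) (mul_nonneg (add_nonneg ?_ ?_) (hx _))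
  · exact mul_nonneg (hφ.1 _) (entry_nonneg (hφ.2.2 _).1 _)
  · refine mul_nonneg (sub_nonneg.mpr (sum_seqLE_le_one hφ _)) ?_
    split_ifs
    · exact zero_le_one
    · exact le_rfl

theorem sum_extendMatrix (hG : G.PerfectRecall) (hφ : IsConvexRep φ)
    (hp : FixedAt φ x (parentSeq j)) (c : G.Act j) :
    ∑ r, extendMatrix φ x j r c = x (parentSeq j) := by
  simp only [extendMatrix, Matrix.of_apply]
  rw [Finset.sum_add_distrib, sum_extendVec hG hφ hp, ← Finset.sum_mul,
    Finset.sum_add_distrib, ← Finset.mul_sum, ← Finset.mul_sum, (hφ.2.2 ⟨j, c⟩).2.1,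
    sum_seqLE_some hG ⟨j, c⟩, Finset.sum_ite_eq' Finset.univ c, if_pos (Finset.mem_univ _)]
  ring

/-- The entries added at `j` distribute the mass of the parent sequence and satisfy the fixed-point
equations at `j`. -/
theorem extendEntries_spec (hG : G.PerfectRecall) {F : G.Oracle} (hF : F.Correct)
    (hφ : IsConvexRep φ) (hx : ∀ σ, 0 ≤ x σ) (hp : FixedAt φ x (parentSeq j)) :
    (∀ a, 0 ≤ extendEntries F φ x j a) ∧
      ∑ a, extendEntries F φ x j a = x (parentSeq j) ∧
      ∀ a, (∑ τ : G.NSeq i with SeqLE (some τ) (some ⟨j, a⟩), φ.1 τ) * extendEntries F φ x j a =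
        ∑ c, φ.1 ⟨j, c⟩ * entry (φ.2 ⟨j, c⟩) (some ⟨j, a⟩) * extendEntries F φ x j c +
          extendVec φ x j a := by
  by_cases h0 : x (parentSeq j) = 0
  · have he : extendEntries F φ x j = 0 := if_pos h0
    have hs := sum_extendVec hG hφ hp
    rw [h0, mul_zero, Finset.sum_eq_zero_iff_of_nonneg fun a _ => extendVec_nonneg hφ hx a] at hs
    refine ⟨fun a => by rw [he]; exact le_rfl, by simp [he, h0], fun a => ?_⟩
    simp [he, hs a (Finset.mem_univ a)]
  · set xp := x (parentSeq j) with hxp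
    set M := xp⁻¹ • extendMatrix φ x j with hM
    have he : extendEntries F φ x j = xp • F i j M := if_neg h0
    obtain ⟨hb, hfix⟩ := hF i j M
      (fun r c => mul_nonneg (inv_nonneg.mpr (hx _)) (extendMatrix_nonneg hφ hx r c))
      (fun c => by
        simp only [hM, Matrix.smul_apply, smul_eq_mul]
        rw [← Finset.mul_sum, sum_extendMatrix hG hφ hp c, inv_mul_cancel₀ h0])
    set b := F i j M
    have hW : ∀ a, ∑ c, extendMatrix φ x j a c * b c = xp * b a := by
      intro a
      have h1 := congrFun hfix a
      simp only [hM, Matrix.mulVec, dotProduct, Matrix.smul_apply, smul_eq_mul, mul_assoc] at h1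
      rw [← Finset.mul_sum] at h1
      rw [← h1, mul_inv_cancel_left₀ h0]
    rw [he]
    refine ⟨fun a => mul_nonneg (hx _) (hb.1 a), ?_, fun a => ?_⟩
    · simp only [Pi.smul_apply, smul_eq_mul]
      rw [← Finset.mul_sum, hb.2, mul_one]
    · have h2 := hW a
      have h3 : ∀ c, extendMatrix φ x j a c * b c = extendVec φ x j a * b c +
          φ.1 ⟨j, c⟩ * entry (φ.2 ⟨j, c⟩) (some ⟨j, a⟩) * (xp * b c) +
          if a = c then (1 - ∑ τ : G.NSeq i with SeqLE (some τ) (some ⟨j, c⟩), φ.1 τ) *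
            (xp * b c) else 0 := by
        intro c
        simp only [extendMatrix, Matrix.of_apply]
        split_ifs <;> ring
      simp only [h3, Finset.sum_add_distrib, Finset.sum_ite_eq, Finset.mem_univ, if_true] at h2
      rw [← Finset.mul_sum, hb.2] at h2
      simp only [Pi.smul_apply, smul_eq_mul]
      linarith

end Extend

/-- `x` solves the constraints of the polytope and the fixed-point equations at the information
sets of `done`. -/
def PartialFixed (φ : G.TransRep i) (done : List (G.InfoSet i)) (x : G.Sequence i → ℝ) : Prop :=
  (∀ σ, 0 ≤ x σ) ∧ x none = 1 ∧ ∀ j ∈ done, x (parentSeq j) = ∑ a : G.Act j, x (some ⟨j, a⟩) ∧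
    ∀ a : G.Act j, FixedAt φ x (some ⟨j, a⟩)

theorem fixedAt_none (φ : G.TransRep i) (x : G.Sequence i → ℝ) : FixedAt φ x none := by
  have h1 : (Finset.univ.filter fun τ : G.NSeq i => SeqLE (some τ) (none : G.Sequence i)) = ∅ :=
    Finset.filter_eq_empty_iff.mpr fun _ _ h => h
  have h2 : (Finset.univ.filter fun τ : G.NSeq i => InfoLESeq τ.1 (none : G.Sequence i)) = ∅ :=
    Finset.filter_eq_empty_iff.mpr fun _ _ h => h
  rw [FixedAt, h1, h2, Finset.sum_empty, Finset.sum_empty, zero_mul]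

theorem partialFixed_extend (hG : G.PerfectRecall) {F : G.Oracle} (hF : F.Correct)
    {φ : G.TransRep i} (hφ : IsConvexRep φ) {done : List (G.InfoSet i)}
    {x : G.Sequence i → ℝ} (hx : PartialFixed φ done x) {j : G.InfoSet i}
    (hpar : ∀ ρ, parentSeq j = some ρ → ρ.1 ∈ done) (hj : ∀ j' ∈ done, ¬ InfoLE j j') :
    PartialFixed φ (done ++ [j]) (extend F φ x j) := by
  have hp : FixedAt φ x (parentSeq j) := by
    cases h : parentSeq j with
    | none => exact fixedAt_none φ x
    | some ρ => exact (hx.2.2 ρ.1 (hpar ρ h)).2 ρ.2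
  obtain ⟨h0, h1, h2⟩ := extendEntries_spec hG hF hφ hx.1 hp
  -- the entries at the sequences that do not lie below `j` are untouched
  have hold : ∀ σ : G.Sequence i, ¬ InfoLESeq j σ → extend F φ x j σ = x σ := by
    intro σ hσ
    cases σ with
    | none => rfl
    | some τ => exact extend_of_ne F φ x fun h => hσ (h ▸ InfoLE.refl _)
  have hup : ∀ σ : G.Sequence i, ¬ InfoLESeq j σ → ∀ τ : G.NSeq i, InfoLESeq τ.1 σ →
      extend F φ x j (some τ) = x (some τ) := fun σ hσ τ hτ =>
    extend_of_ne F φ x fun h => hσ (h ▸ hτ)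
  refine ⟨fun σ => ?_, hx.2.1, fun j' hj' => ?_⟩
  · cases σ with
    | none => exact hx.1 none
    | some τ =>
      obtain ⟨j', a⟩ := τ
      by_cases h : j' = j
      · subst h
        rw [extend_self]
        exact h0 a
      · rw [extend_of_ne F φ x h]
        exact hx.1 _
  · rcases List.mem_append.mp hj' with hd | hd
    · have hσ : ∀ a, ¬ InfoLESeq j (some ⟨j', a⟩) := fun a => hj j' hd
      have hσp : ¬ InfoLESeq j (parentSeq j') := fun h =>
        hj j' hd ((infoLE_iff hG _ _).mpr (Or.inr h))
      obtain ⟨e1, e2⟩ := hx.2.2 j' hd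
      refine ⟨?_, fun a => ?_⟩
      · rw [hold _ hσp, e1]
        exact Finset.sum_congr rfl fun a _ => (hold _ (hσ a)).symm
      · have e3 := e2 a
        unfold FixedAt at e3 ⊢
        rw [hold _ (hσ a), e3]
        refine Finset.sum_congr rfl fun τ hτ => ?_
        rw [hup _ (hσ a) τ (Finset.mem_filter.mp hτ).2]
    · obtain rfl := List.mem_singleton.mp hd
      refine ⟨?_, fun a => ?_⟩
      · rw [hold _ (not_infoLESeq_parentSeq hG _), ← h1]
        exact Finset.sum_congr rfl fun a _ => (extend_self F φ x _ a).symm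
      · unfold FixedAt
        rw [extend_self, h2 a, sum_infoLESeq_some hG]
        simp only [extend_self]
        congr 1
        refine Finset.sum_congr rfl fun τ hτ => ?_
        rw [hup _ (not_infoLESeq_parentSeq hG _) τ (Finset.mem_filter.mp hτ).2]

theorem partialFixed_foldl (hG : G.PerfectRecall) {F : G.Oracle} (hF : F.Correct)
    {φ : G.TransRep i} (hφ : IsConvexRep φ) {l : List (G.InfoSet i)} (hl : TopDown l)
    (post : List (G.InfoSet i)) :
    ∀ (pre : List (G.InfoSet i)) (x : G.Sequence i → ℝ), pre ++ post = l →
      PartialFixed φ pre x → PartialFixed φ l (post.foldl (extend F φ) x) := by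
  induction post with
  | nil =>
    intro pre x he hx
    rw [List.append_nil] at he
    exact he ▸ hx
  | cons j post ih =>
    intro pre x he hx
    obtain ⟨-, hmem, hpw⟩ := hl
    rw [← he, List.pairwise_append] at hpw
    obtain ⟨-, hpw2, hpw3⟩ := hpw
    refine ih (pre ++ [j]) _ (by simpa using he) (partialFixed_extend hG hF hφ hx ?_ ?_)
    · intro ρ hρ
      have hle : InfoLESeq ρ.1 (parentSeq j) := hρ ▸ InfoLE.refl ρ.1
      have h1 := hmem ρ.1
      rw [← he, List.mem_append, List.mem_cons] at h1
      rcases h1 with h1 | h1 | h1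
      · exact h1
      · exact absurd (h1 ▸ hle) (not_infoLESeq_parentSeq hG j)
      · exact absurd ((infoLE_iff hG _ _).mpr (Or.inr hle))
          ((List.pairwise_cons.mp hpw2).1 _ h1)
    · exact fun j' hj' => hpw3 j' hj' j List.mem_cons_self

theorem partialFixed_fixedPoint (hG : G.PerfectRecall) {F : G.Oracle} (hF : F.Correct)
    {φ : G.TransRep i} (hφ : IsConvexRep φ) {l : List (G.InfoSet i)} (hl : TopDown l) :
    PartialFixed φ l (fixedPoint F l φ) := by
  refine partialFixed_foldl hG hF hφ hl l [] _ rfl ⟨fun σ => ?_, ?_, ?_⟩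
  · by_cases h : σ = none
    · simp [h]
    · simp [h]
  · simp
  · simp

theorem fixedPoint_mem_seqPolytope (hG : G.PerfectRecall) {F : G.Oracle} (hF : F.Correct)
    {φ : G.TransRep i} (hφ : IsConvexRep φ) {l : List (G.InfoSet i)} (hl : TopDown l) :
    fixedPoint F l φ ∈ G.seqPolytope i := by
  obtain ⟨h1, h2, h3⟩ := partialFixed_fixedPoint hG hF hφ hl
  exact ⟨h1, h2, fun j => (h3 j (hl.2.1 j)).1⟩

theorem sum_smul_trigMap_fixedPoint (hG : G.PerfectRecall) {F : G.Oracle} (hF : F.Correct)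
    {φ : G.TransRep i} (hφ : IsConvexRep φ) (hφ1 : ∑ τ, φ.1 τ = 1)
    {l : List (G.InfoSet i)} (hl : TopDown l) :
    ∑ τ, φ.1 τ • trigMap τ (φ.2 τ) (fixedPoint F l φ) = fixedPoint F l φ := by
  obtain ⟨-, -, h3⟩ := partialFixed_fixedPoint hG hF hφ hl
  set x := fixedPoint F l φ
  have hfix : ∀ σ, FixedAt φ x σ := fun σ => by
    cases σ with
    | none => exact fixedAt_none φ x
    | some τ => exact (h3 τ.1 (hl.2.1 τ.1)).2 τ.2
  ext σ
  have h4 := hfix σ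
  unfold FixedAt at h4
  rw [Finset.sum_filter, Finset.sum_filter, Finset.sum_mul] at h4
  rw [Finset.sum_apply]
  calc ∑ τ, (φ.1 τ • trigMap τ (φ.2 τ) x) σ
      = ∑ τ, (φ.1 τ * x σ - (if SeqLE (some τ) σ then φ.1 τ else 0) * x σ +
          if InfoLESeq τ.1 σ then φ.1 τ * entry (φ.2 τ) σ * x (some τ) else 0) := by
        refine Finset.sum_congr rfl fun τ _ => ?_
        rw [Pi.smul_apply, trigMap_apply, smul_eq_mul]
        split_ifs <;> ring
    _ = x σ := by
        rw [Finset.sum_add_distrib, Finset.sum_sub_distrib, ← h4, ← Finset.sum_mul, hφ1]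
        ring

/-! ### Regret of the mixed strategies against trigger deviations -/

variable (G i) in
/-- The state of the algorithm of a player: the cumulative regrets of the triggers, and for every
trigger the cumulative counterfactual regrets of its CFR algorithm. -/
abbrev PlayerState : Type u := (G.NSeq i → ℝ) × ((τ : G.NSeq i) → SubSeq τ.1 → ℝ)

/-- The transformation computed from a state. -/
noncomputable def PlayerState.rep (s : PlayerState G i) : G.TransRep i :=
  (rmStrategy s.1, fun τ => toSeqForm (cfrBehavior (s.2 τ)))

/-- The mixed strategy computed from a state. -/
noncomputable def PlayerState.mixed (F : G.Oracle) (l : List (G.InfoSet i))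
    (s : PlayerState G i) : G.Sequence i → ℝ :=
  fixedPoint F l s.rep

/-- The successor of a state when the utility function `ℓ` is observed. -/
noncomputable def PlayerState.update (F : G.Oracle) (l : List (G.InfoSet i))
    (s : PlayerState G i) (ℓ : (G.Sequence i → ℝ) →ₗ[ℝ] ℝ) : PlayerState G i :=
  (rmUpdate s.1 fun τ => ℓ (trigMap τ (s.rep.2 τ) (s.mixed F l)), fun τ ρ =>
    s.2 τ ρ + cfRegret (cfrBehavior (s.2 τ))
      (shiftedUtility τ (ℓ ∘ₗ LinearMap.applyₗ (s.mixed F l))) ρ)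

/-- The CFR components agree by definition; for the regret matching over the triggers, the observed
linear function is evaluated at the vertices of the simplex. -/
theorem mixedAlg_observe (F : G.Oracle) (l : List (G.InfoSet i)) (s : PlayerState G i)
    (ℓ : (G.Sequence i → ℝ) →ₗ[ℝ] ℝ) :
    (mixedAlg F l).observe s ℓ = s.update F l ℓ := by
  refine Prod.ext ?_ rfl
  change rmUpdate s.1 _ = rmUpdate s.1 _
  congr 1
  ext τ
  simp only [LinearMap.sum_apply, LinearMap.smul_apply, LinearMap.proj_apply, smul_eq_mul,
    Pi.single_apply, mul_ite, mul_one, mul_zero, Finset.sum_ite_eq', Finset.mem_univ, if_true]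
  rfl

/-- The state of Player `i` after the profiles of `hist` have been played. -/
noncomputable def playerState (F : G.Oracle) (ord : (i : Fin n) → List (G.InfoSet i))
    (hist : List G.Profile) (i : Fin n) : PlayerState G i :=
  stateAfter F ord hist i

theorem playerState_append (F : G.Oracle) (ord : (i : Fin n) → List (G.InfoSet i))
    (hist : List G.Profile) (p : G.Profile) (i : Fin n) :
    playerState F ord (hist ++ [p]) i =
      (playerState F ord hist i).update F (ord i) (utility i p) := by
  rw [← mixedAlg_observe]
  unfold playerState stateAfter
  rw [List.foldl_append]
  rfl

theorem isConvexRep_rep (hG : G.PerfectRecall) (s : PlayerState G i) : IsConvexRep s.rep :=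
  ⟨fun τ => rmStrategy_nonneg _ τ, sum_rmStrategy_le_one _, fun _ =>
    toSeqForm_mem_subPolytope hG (isBehavior_cfrBehavior _)⟩

theorem mixed_mem_seqPolytope (hG : G.PerfectRecall) {F : G.Oracle} (hF : F.Correct)
    {l : List (G.InfoSet i)} (hl : TopDown l) (s : PlayerState G i) :
    s.mixed F l ∈ G.seqPolytope i :=
  fixedPoint_mem_seqPolytope hG hF (isConvexRep_rep hG s) hl

/-- The gain of Player `i` from deviating from `x` by the trigger deviation `(τ, y)` when the other
players play according to `p`. -/
noncomputable def devGain (p : G.Profile) (τ : G.NSeq i) (y : SubSeq τ.1 → ℝ) :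
    (G.Sequence i → ℝ) →ₗ[ℝ] ℝ :=
  utility i p ∘ₗ (trigMap τ y - LinearMap.id)

theorem devGain_apply (p : G.Profile) (τ : G.NSeq i) (y : SubSeq τ.1 → ℝ)
    (x : G.Sequence i → ℝ) :
    devGain p τ y x = utility i p (trigMap τ y x) - utility i p x := by
  simp [devGain]

theorem abs_devGain_le (hG : G.PerfectRecall) (p : G.Profile) (τ : G.NSeq i)
    {y : SubSeq τ.1 → ℝ} (hy : y ∈ subPolytope τ.1) {x : G.Sequence i → ℝ}
    (hx : x ∈ G.seqPolytope i) : |devGain p τ y x| ≤ G.payoffRange := by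
  rw [devGain_apply]
  exact abs_utility_sub_le hG p (trigMap_mem_seqPolytope hG τ hy hx) hx

section Step

variable {F : G.Oracle} {l : List (G.InfoSet i)}

/-- The value that regret matching over the triggers expects is the utility of the mixed strategy,
because the latter is a fixed point. -/
theorem sum_rmStrategy_mul_utility (hG : G.PerfectRecall) (hF : F.Correct) (hl : TopDown l)
    (s : PlayerState G i) [Nonempty (G.NSeq i)] (ℓ : (G.Sequence i → ℝ) →ₗ[ℝ] ℝ) :
    ∑ τ, rmStrategy s.1 τ * ℓ (trigMap τ (s.rep.2 τ) (s.mixed F l)) = ℓ (s.mixed F l) := by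
  have h := congrArg ℓ
    (sum_smul_trigMap_fixedPoint hG hF (isConvexRep_rep hG s) (sum_rmStrategy s.1) hl)
  rw [map_sum] at h
  simp only [map_smul, smul_eq_mul] at h
  exact h

theorem shiftedUtility_sub (τ : G.NSeq i)
    (L : ((G.Sequence i → ℝ) →ₗ[ℝ] (G.Sequence i → ℝ)) →ₗ[ℝ] ℝ) (y y' : SubSeq τ.1 → ℝ) :
    shiftedUtility τ L y - shiftedUtility τ L y' = L (trigMap τ y) - L (trigMap τ y') :=
  sub_sub_sub_cancel_right _ _ _

theorem sq_le_payoffRange_sq {a : ℝ} (h : |a| ≤ G.payoffRange) : a ^ 2 ≤ G.payoffRange ^ 2 :=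
  sq_le_sq' (abs_le.mp h).1 (abs_le.mp h).2

theorem card_subSeq_le (τ : G.NSeq i) : Fintype.card (SubSeq τ.1) ≤ Fintype.card (G.NSeq i) :=
  Fintype.card_subtype_le _

theorem potential_fst_update_le (hG : G.PerfectRecall) (hF : F.Correct) (hl : TopDown l)
    (s : PlayerState G i) (p : G.Profile) [Nonempty (G.NSeq i)] :
    ∑ τ, (max ((s.update F l (utility i p)).1 τ) 0) ^ 2 ≤
      ∑ τ, (max (s.1 τ) 0) ^ 2 + Fintype.card (G.NSeq i) * G.payoffRange ^ 2 := by
  refine (sum_posPart_rmUpdate_sq_le _ _).trans (add_le_add_right ?_ _)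
  rw [sum_rmStrategy_mul_utility hG hF hl]
  refine (Finset.sum_le_card_nsmul _ _ (G.payoffRange ^ 2) fun τ _ => ?_).trans ?_
  · refine sq_le_payoffRange_sq (abs_utility_sub_le hG p ?_ (mixed_mem_seqPolytope hG hF hl s))
    exact trigMap_mem_seqPolytope hG τ ((isConvexRep_rep hG s).2.2 τ)
      (mixed_mem_seqPolytope hG hF hl s)
  · rw [nsmul_eq_mul, Finset.card_univ]

theorem potential_snd_update_le (hG : G.PerfectRecall) (hF : F.Correct) (hl : TopDown l)
    (s : PlayerState G i) (p : G.Profile) (τ : G.NSeq i) :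
    ∑ ρ, (max ((s.update F l (utility i p)).2 τ ρ) 0) ^ 2 ≤
      ∑ ρ, (max (s.2 τ ρ) 0) ^ 2 + Fintype.card (G.NSeq i) * G.payoffRange ^ 2 := by
  refine (sum_posPart_cfr_sq_le _ _).trans (add_le_add_right ?_ _)
  refine (Finset.sum_le_card_nsmul _ _ (G.payoffRange ^ 2) fun ρ _ => ?_).trans ?_
  · refine sq_le_payoffRange_sq (abs_cfRegret_le hG (isBehavior_cfrBehavior _) ?_ ρ)
    intro y hy y' hy'
    rw [shiftedUtility_sub]
    exact abs_utility_sub_le hG p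
      (trigMap_mem_seqPolytope hG τ hy (mixed_mem_seqPolytope hG hF hl s))
      (trigMap_mem_seqPolytope hG τ hy' (mixed_mem_seqPolytope hG hF hl s))
  · rw [nsmul_eq_mul, Finset.card_univ]
    exact mul_le_mul_of_nonneg_right (by exact_mod_cast card_subSeq_le τ) (sq_nonneg _)

/-- The instantaneous regret against the deviation `(τ, y)` is the sum of the increments of the
cumulative regrets of the trigger `τ` and of its CFR algorithm. -/
theorem cumulativeRegret_update (hG : G.PerfectRecall) (hF : F.Correct) (hl : TopDown l)
    (s : PlayerState G i) (p : G.Profile) (τ : G.NSeq i) {y : SubSeq τ.1 → ℝ}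
    (hy : y ∈ subPolytope τ.1) :
    (s.update F l (utility i p)).1 τ + ∑ ρ, y ρ * (s.update F l (utility i p)).2 τ ρ =
      s.1 τ + ∑ ρ, y ρ * s.2 τ ρ + devGain p τ y (s.mixed F l) := by
  have : Nonempty (G.NSeq i) := ⟨τ⟩
  have h1 := sum_rmStrategy_mul_utility hG hF hl s (utility i p)
  have h2 := sum_mul_cfRegret hG (cfrBehavior (s.2 τ)) hy
    (shiftedUtility τ (utility i p ∘ₗ LinearMap.applyₗ (s.mixed F l)))
  rw [shiftedUtility_sub] at h2
  simp only [LinearMap.comp_apply, LinearMap.applyₗ_apply_apply] at h2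
  rw [devGain_apply]
  simp only [PlayerState.update, rmUpdate, h1, mul_add, Finset.sum_add_distrib, h2]
  simp only [PlayerState.rep]
  ring

end Step

/-- The mixed strategy of Player `i` after the profiles of `hist` have been played. -/
noncomputable def mixedAt (F : G.Oracle) (ord : (i : Fin n) → List (G.InfoSet i))
    (hist : List G.Profile) (i : Fin n) : G.Sequence i → ℝ :=
  (playerState F ord hist i).mixed F (ord i)

section Cumulative

variable {F : G.Oracle} {ord : (i : Fin n) → List (G.InfoSet i)}

theorem sum_devGain_mixed (hG : G.PerfectRecall) (hF : F.Correct)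
    (hord : ∀ i, TopDown (ord i)) (τ : G.NSeq i) {y : SubSeq τ.1 → ℝ}
    (hy : y ∈ subPolytope τ.1) : ∀ (T : ℕ) (x : Fin T → G.Profile),
    ∑ t, devGain (x t) τ y (mixedAt F ord ((List.ofFn x).take t) i) =
      (playerState F ord (List.ofFn x) i).1 τ +
        ∑ ρ, y ρ * (playerState F ord (List.ofFn x) i).2 τ ρ := by
  intro T
  induction T with
  | zero =>
    intro x
    simp only [Finset.univ_eq_empty, Finset.sum_empty, List.ofFn_zero]
    have h1 : (playerState F ord [] i).1 τ = 0 := rfl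
    have h2 : ∀ ρ, (playerState F ord [] i).2 τ ρ = 0 := fun ρ => rfl
    simp [h1, h2]
  | succ T ih =>
    intro x
    have e : ∀ t : Fin T, (List.ofFn x).take (t.castSucc : Fin (T + 1)) =
        (List.ofFn fun s : Fin T => x s.castSucc).take t := fun t =>
      take_ofFn_castSucc x t.2.le
    have e' : (List.ofFn x).take (Fin.last T : Fin (T + 1)) =
        List.ofFn fun s : Fin T => x s.castSucc := by
      rw [take_ofFn_castSucc x (by simp), List.take_of_length_le (by simp)]
    rw [Fin.sum_univ_castSucc]
    simp only [e, e']
    rw [ih, ofFn_succ_eq_append x, playerState_append, cumulativeRegret_update hG hF (hord i) _ _ τ hy]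
    rfl

theorem potential_fst_le (hG : G.PerfectRecall) (hF : F.Correct)
    (hord : ∀ i, TopDown (ord i)) [Nonempty (G.NSeq i)] (hist : List G.Profile) :
    ∑ τ, (max ((playerState F ord hist i).1 τ) 0) ^ 2 ≤
      hist.length * (Fintype.card (G.NSeq i) * G.payoffRange ^ 2) := by
  induction hist using List.reverseRecOn with
  | nil =>
    have h1 : ∀ τ, (playerState F ord [] i).1 τ = 0 := fun τ => rfl
    simp [h1]
  | append_singleton hist p ih =>
    rw [playerState_append, List.length_append, List.length_singleton]
    refine (potential_fst_update_le hG hF (hord i) _ p).trans ?_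
    push_cast
    linarith

theorem potential_snd_le (hG : G.PerfectRecall) (hF : F.Correct)
    (hord : ∀ i, TopDown (ord i)) (τ : G.NSeq i) (hist : List G.Profile) :
    ∑ ρ, (max ((playerState F ord hist i).2 τ ρ) 0) ^ 2 ≤
      hist.length * (Fintype.card (G.NSeq i) * G.payoffRange ^ 2) := by
  induction hist using List.reverseRecOn with
  | nil =>
    have h1 : ∀ ρ, (playerState F ord [] i).2 τ ρ = 0 := fun ρ => rfl
    simp [h1]
  | append_singleton hist p ih =>
    rw [playerState_append, List.length_append, List.length_singleton]
    refine (potential_snd_update_le hG hF (hord i) _ p τ).trans ?_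
    push_cast
    linarith

/-- The regret of the mixed strategies against a deterministic trigger deviation: the regret of
regret matching over the triggers contributes `D √N √T`, and that of CFR `D N √T`. -/
theorem sum_devGain_mixed_le (hG : G.PerfectRecall) (hF : F.Correct)
    (hord : ∀ i, TopDown (ord i)) (τ : G.NSeq i) {y : SubSeq τ.1 → ℝ}
    (hy : y ∈ subPure τ.1) {T : ℕ} (x : Fin T → G.Profile) :
    ∑ t, devGain (x t) τ y (mixedAt F ord ((List.ofFn x).take t) i) ≤
      G.payoffRange * √T * (√(Fintype.card (G.NSeq i)) + Fintype.card (G.NSeq i)) := by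
  have : Nonempty (G.NSeq i) := ⟨τ⟩
  rw [sum_devGain_mixed hG hF hord τ hy.1]
  have h1 := potential_fst_le hG hF hord (i := i) (List.ofFn x)
  have h2 := potential_snd_le hG hF hord τ (List.ofFn x)
  rw [List.length_ofFn] at h1 h2
  set s := playerState F ord (List.ofFn x) i
  set N : ℝ := ((Fintype.card (G.NSeq i) : ℕ) : ℝ)
  have hD := payoffRange_nonneg G
  have hN0 : 0 ≤ N := Nat.cast_nonneg _
  have hsq : √(T * (N * G.payoffRange ^ 2)) = G.payoffRange * √T * √N := by
    rw [Real.sqrt_mul (Nat.cast_nonneg _), Real.sqrt_mul hN0, Real.sqrt_sq hD]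
    ring
  have h3 : s.1 τ ≤ G.payoffRange * √T * √N := by
    rw [← hsq]
    refine (le_max_left _ 0).trans (Real.le_sqrt_of_sq_le (le_trans ?_ h1))
    exact Finset.single_le_sum (f := fun τ => (max (s.1 τ) 0) ^ 2)
      (fun _ _ => sq_nonneg _) (Finset.mem_univ τ)
  have h4 : ∑ ρ, y ρ * s.2 τ ρ ≤ G.payoffRange * √T * N := by
    have hy2 : ∑ ρ, y ρ ^ 2 ≤ N := by
      refine (Finset.sum_le_card_nsmul _ _ 1 fun ρ _ => ?_).trans ?_
      · rcases hy.2 ρ with h | h <;> simp [h]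
      · rw [nsmul_eq_mul, Finset.card_univ, mul_one]
        exact Nat.cast_le.mpr (card_subSeq_le τ)
    calc ∑ ρ, y ρ * s.2 τ ρ ≤ ∑ ρ, y ρ * max (s.2 τ ρ) 0 :=
          Finset.sum_le_sum fun ρ _ =>
            mul_le_mul_of_nonneg_left (le_max_left _ _) (hy.1.1 ρ)
      _ ≤ √(∑ ρ, y ρ ^ 2) * √(∑ ρ, (max (s.2 τ ρ) 0) ^ 2) :=
          Real.sum_mul_le_sqrt_mul_sqrt _ _ _
      _ ≤ √N * (G.payoffRange * √T * √N) := by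
          rw [← hsq]
          exact mul_le_mul (Real.sqrt_le_sqrt hy2) (Real.sqrt_le_sqrt h2)
            (Real.sqrt_nonneg _) (Real.sqrt_nonneg _)
      _ = G.payoffRange * √T * (√N * √N) := by ring
      _ = _ := by rw [Real.mul_self_sqrt hN0]
  rw [mul_add]
  exact add_le_add h3 h4

end Cumulative

/-! ### The natural sampling scheme -/

theorem le_parentSeq {q : G.Sequence i → ℝ} (hq : q ∈ G.seqPolytope i) (τ : G.NSeq i) :
    q (some τ) ≤ q (parentSeq τ.1) := by
  rw [hq.2.2 τ.1]
  exact Finset.single_le_sum (f := fun a : G.Act τ.1 => q (some ⟨τ.1, a⟩))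
    (fun a _ => hq.1 _) (Finset.mem_univ τ.2)

theorem eq_one_parentSeq (p : G.PureStrategy i) {τ : G.NSeq i} (h : p.1 (some τ) = 1) :
    p.1 (parentSeq τ.1) = 1 := by
  have h1 := le_parentSeq p.2.1 τ
  rcases p.2.2 (parentSeq τ.1) with h2 | h2
  · rw [h, h2] at h1
    linarith
  · exact h2

theorem eq_of_eq_one (p : G.PureStrategy i) {j : G.InfoSet i} {a a' : G.Act j}
    (h : p.1 (some ⟨j, a⟩) = 1) (h' : p.1 (some ⟨j, a'⟩) = 1) : a = a' := by
  by_contra hne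
  have h1 : p.1 (parentSeq j) = 1 := eq_one_parentSeq p h
  have h2 := Finset.add_le_sum (f := fun a : G.Act j => p.1 (some ⟨j, a⟩))
    (fun a _ => p.2.1.1 _) (Finset.mem_univ a) (Finset.mem_univ a') hne
  rw [← p.2.1.2.2 j, h1, h, h'] at h2
  linarith

/-- The behavioral strategy induced by a sequence-form strategy, uniform at the information sets
that it does not reach. -/
noncomputable def behavior (q : G.Sequence i → ℝ) (τ : G.NSeq i) : ℝ :=
  if q (parentSeq τ.1) = 0 then 1 / (Fintype.card (G.Act τ.1) : ℝ)
  else q (some τ) / q (parentSeq τ.1)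

theorem sum_behavior {q : G.Sequence i → ℝ} (hq : q ∈ G.seqPolytope i) (j : G.InfoSet i) :
    ∑ a : G.Act j, behavior q ⟨j, a⟩ = 1 := by
  change ∑ a : G.Act j, (if q (parentSeq j) = 0 then 1 / (Fintype.card (G.Act j) : ℝ)
    else q (some ⟨j, a⟩) / q (parentSeq j)) = 1
  split_ifs with h
  · rw [Finset.sum_const, Finset.card_univ, nsmul_eq_mul,
      mul_one_div_cancel (Nat.cast_ne_zero.mpr Fintype.card_ne_zero)]
  · rw [← Finset.sum_div, ← hq.2.2 j, div_self h]

theorem behavior_mul {q : G.Sequence i → ℝ} (hq : q ∈ G.seqPolytope i) (τ : G.NSeq i) :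
    behavior q τ * q (parentSeq τ.1) = q (some τ) := by
  unfold behavior
  split_ifs with h
  · have h1 := le_parentSeq hq τ
    have h2 := hq.1 (some τ)
    rw [h] at h1 ⊢
    linarith
  · exact div_mul_cancel₀ _ h

/-- The sequence-form representation of a choice of one action at every information set. -/
noncomputable def pureOf (b : (j : G.InfoSet i) → G.Act j) (σ : G.Sequence i) : ℝ :=
  if ∀ (j : G.InfoSet i) (a : G.Act j), SeqLE (some ⟨j, a⟩) σ → b j = a then 1 else 0

theorem pureOf_some (hG : G.PerfectRecall) (b : (j : G.InfoSet i) → G.Act j)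
    (j : G.InfoSet i) (a : G.Act j) :
    pureOf b (some ⟨j, a⟩) = if b j = a then pureOf b (parentSeq j) else 0 := by
  have h : (∀ (j' : G.InfoSet i) (a' : G.Act j'), SeqLE (some ⟨j', a'⟩) (some ⟨j, a⟩) →
      b j' = a') ↔ b j = a ∧ ∀ (j' : G.InfoSet i) (a' : G.Act j'),
        SeqLE (some ⟨j', a'⟩) (parentSeq j) → b j' = a' := by
    constructor
    · exact fun h => ⟨h j a (SeqLE.refl _), fun j' a' h' =>
        h j' a' ((seqLE_some_iff hG _ _).mpr (Or.inr h'))⟩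
    · rintro ⟨h1, h2⟩ j' a' h'
      rcases (seqLE_some_iff hG _ _).mp h' with h3 | h3
      · cases h3
        exact h1
      · exact h2 j' a' h3
  unfold pureOf
  rw [if_congr h rfl rfl, ite_and]

theorem pureOf_mem (hG : G.PerfectRecall) (b : (j : G.InfoSet i) → G.Act j) :
    pureOf b ∈ G.pureSet i := by
  refine ⟨⟨fun σ => ?_, ?_, fun j => ?_⟩, fun σ => ?_⟩
  · unfold pureOf
    split_ifs <;> norm_num
  · exact if_pos fun j a h => h.elim
  · simp only [pureOf_some hG, Finset.sum_ite_eq, Finset.mem_univ, if_true]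
  · unfold pureOf
    split_ifs
    · exact Or.inr rfl
    · exact Or.inl rfl

/-- The deterministic strategy given by a choice of one action at every information set. -/
noncomputable def pureStrategyOf (hG : G.PerfectRecall) (b : (j : G.InfoSet i) → G.Act j) :
    G.PureStrategy i :=
  ⟨pureOf b, pureOf_mem hG b⟩

theorem pureStrategyOf_eq_iff (hG : G.PerfectRecall) (b : (j : G.InfoSet i) → G.Act j)
    (p : G.PureStrategy i) : pureStrategyOf hG b = p ↔
      ∀ (j : G.InfoSet i) (a : G.Act j), p.1 (some ⟨j, a⟩) = 1 → b j = a := by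
  constructor
  · rintro rfl j a h
    have h1 : pureOf b (some ⟨j, a⟩) = 1 := h
    rw [pureOf_some hG] at h1
    by_contra hne
    rw [if_neg hne] at h1
    exact zero_ne_one h1
  · intro h
    have step : ∀ j a, pureOf b (parentSeq j) = p.1 (parentSeq j) →
        pureOf b (some ⟨j, a⟩) = p.1 (some ⟨j, a⟩) := by
      intro j a hj
      have hsum := p.2.1.2.2 j
      have hzero : ∀ a', b j ≠ a' → p.1 (some ⟨j, a'⟩) = 0 := fun a' hne =>
        (p.2.2 _).resolve_right fun h1 => hne (h j a' h1)
      rw [Finset.sum_eq_single (b j) (fun a' _ hne => hzero a' hne.symm)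
        fun h => absurd (Finset.mem_univ _) h] at hsum
      rw [pureOf_some hG]
      split_ifs with hb
      · subst hb
        rw [hj, hsum]
      · exact (hzero a hb).symm
    have hpar : ∀ j : G.InfoSet i, pureOf b (parentSeq j) = p.1 (parentSeq j) := by
      intro j
      induction j using infoSet_induction hG with
      | step j ih =>
        cases hp : parentSeq j with
        | none => rw [(pureOf_mem hG b).1.2.1, p.2.1.2.1]
        | some ρ => exact step ρ.1 ρ.2 (ih ρ hp)
    apply Subtype.ext
    funext σ
    cases σ with
    | none => exact (pureOf_mem hG b).1.2.1.trans p.2.1.2.1.symm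
    | some ρ => exact step ρ.1 ρ.2 (hpar ρ.1)

/-- Where `q` vanishes on a sequence played by `p`, both products vanish: the first such sequence on
its path contributes a zero factor to either. -/
theorem prod_behavior_eq_naturalSampling (hG : G.PerfectRecall) {q : G.Sequence i → ℝ}
    (hq : q ∈ G.seqPolytope i) (p : G.PureStrategy i) :
    ∏ τ : G.NSeq i with p.1 (some τ) = 1, behavior q τ = naturalSampling q p := by
  unfold naturalSampling
  by_cases h : ∀ τ : G.NSeq i, p.1 (some τ) = 1 → q (parentSeq τ.1) ≠ 0
  · exact Finset.prod_congr rfl fun τ hτ => if_neg (h τ (Finset.mem_filter.mp hτ).2)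
  · push Not at h
    obtain ⟨τ, hτ1, hτ0⟩ := h
    let S : Finset (G.NSeq i) := Finset.univ.filter fun ρ => p.1 (some ρ) = 1 ∧ q (some ρ) = 0
    have hS : S.Nonempty := by
      refine ⟨τ, Finset.mem_filter.mpr ⟨Finset.mem_univ _, hτ1, ?_⟩⟩
      exact le_antisymm (hτ0 ▸ le_parentSeq hq τ) (hq.1 _)
    obtain ⟨ρ, hρ, hmin⟩ := S.exists_min_image (fun ρ => depth ρ.1) hS
    obtain ⟨-, hρ1, hρ0⟩ := Finset.mem_filter.mp hρ
    have hpar : q (parentSeq ρ.1) ≠ 0 := by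
      cases hp : parentSeq ρ.1 with
      | none => rw [hq.2.1]; exact one_ne_zero
      | some ρ' =>
        intro h0
        have h1 : ρ' ∈ S :=
          Finset.mem_filter.mpr ⟨Finset.mem_univ _, hp ▸ eq_one_parentSeq p hρ1, h0⟩
        exact absurd (hmin ρ' h1) (not_le.mpr (depth_lt hG hp))
    have hmem : ρ ∈ Finset.univ.filter fun τ : G.NSeq i => p.1 (some τ) = 1 :=
      Finset.mem_filter.mpr ⟨Finset.mem_univ _, hρ1⟩
    rw [Finset.prod_eq_zero hmem, Finset.prod_eq_zero hmem]
    · rw [hρ0, zero_div]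
    · rw [behavior, if_neg hpar, hρ0, zero_div]

/-- The natural sampling scheme is the image of drawing an action at every information set,
independently, according to the induced behavioral strategy. -/
theorem naturalSampling_eq_sum (hG : G.PerfectRecall) {q : G.Sequence i → ℝ}
    (hq : q ∈ G.seqPolytope i) (p : G.PureStrategy i) :
    naturalSampling q p = ∑ b : (j : G.InfoSet i) → G.Act j with pureStrategyOf hG b = p,
      ∏ j, behavior q ⟨j, b j⟩ := by
  let S : (j : G.InfoSet i) → Finset (G.Act j) := fun j =>
    Finset.univ.filter fun a => ∀ a', p.1 (some ⟨j, a'⟩) = 1 → a = a'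
  have hS : (Finset.univ.filter fun b : (j : G.InfoSet i) → G.Act j =>
      pureStrategyOf hG b = p) = Fintype.piFinset S := by
    ext b
    simp [S, pureStrategyOf_eq_iff]
  rw [hS, ← Finset.prod_univ_sum S fun j a => behavior q ⟨j, a⟩,
    ← prod_behavior_eq_naturalSampling hG hq, Finset.prod_filter, Fintype.prod_sigma]
  refine Finset.prod_congr rfl fun j _ => ?_
  by_cases h : ∃ a₀, p.1 (some ⟨j, a₀⟩) = 1
  · obtain ⟨a₀, h₀⟩ := h
    have h1 : S j = {a₀} := by
      ext a
      simp only [S, Finset.mem_filter, Finset.mem_univ, true_and, Finset.mem_singleton]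
      exact ⟨fun h => h a₀ h₀, fun h a' h' => h.trans (eq_of_eq_one p h₀ h')⟩
    rw [h1, Finset.sum_singleton, Finset.prod_eq_single a₀, if_pos h₀]
    · exact fun a _ hne => if_neg fun h => hne (eq_of_eq_one p h h₀)
    · exact fun h => absurd (Finset.mem_univ _) h
  · have h1 : S j = Finset.univ := by
      refine Finset.filter_true_of_mem fun a _ a' h' => absurd ⟨a', h'⟩ h
    rw [h1, sum_behavior hq]
    exact Finset.prod_eq_one fun a _ => if_neg fun h' => h ⟨a, h'⟩

theorem naturalSampling_nonneg {q : G.Sequence i → ℝ} (hq : q ∈ G.seqPolytope i)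
    (p : G.PureStrategy i) : 0 ≤ naturalSampling q p :=
  Finset.prod_nonneg fun _ _ => div_nonneg (hq.1 _) (hq.1 _)

theorem sum_naturalSampling (hG : G.PerfectRecall) {q : G.Sequence i → ℝ}
    (hq : q ∈ G.seqPolytope i) : ∑ p, naturalSampling q p = 1 := by
  simp only [naturalSampling_eq_sum hG hq]
  rw [Finset.sum_fiberwise, ← Fintype.piFinset_univ,
    ← Finset.prod_univ_sum (fun _ => Finset.univ) fun j a => behavior q ⟨j, a⟩]
  exact Finset.prod_eq_one fun j _ => sum_behavior hq j

/-- The actions at `j` that do not leave the path of `σ`. -/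
noncomputable def consistentActs (σ : G.Sequence i) (j : G.InfoSet i) : Finset (G.Act j) :=
  Finset.univ.filter fun a => ∀ a', SeqLE (some ⟨j, a'⟩) σ → a = a'

theorem mem_consistentActs {σ : G.Sequence i} {j : G.InfoSet i} {a : G.Act j} :
    a ∈ consistentActs σ j ↔ ∀ a', SeqLE (some ⟨j, a'⟩) σ → a = a' := by
  simp [consistentActs]

theorem consistentActs_self (hG : G.PerfectRecall) (j : G.InfoSet i) (a : G.Act j) :
    consistentActs (some ⟨j, a⟩) j = {a} := by
  ext b
  rw [mem_consistentActs, Finset.mem_singleton]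
  exact ⟨fun h => h a (SeqLE.refl _), fun h a' h' => h.trans (act_unique hG (SeqLE.refl _) h')⟩

theorem consistentActs_parentSeq (hG : G.PerfectRecall) (j : G.InfoSet i) :
    consistentActs (parentSeq j) j = Finset.univ :=
  Finset.filter_true_of_mem fun _ _ a' h =>
    absurd h (not_seqLE_parentSeq hG (⟨j, a'⟩ : G.NSeq i))

theorem consistentActs_of_ne (hG : G.PerfectRecall) {j j' : G.InfoSet i} (a : G.Act j)
    (h : j' ≠ j) : consistentActs (some ⟨j, a⟩) j' = consistentActs (parentSeq j) j' := by
  ext b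
  rw [mem_consistentActs, mem_consistentActs]
  refine forall_congr' fun a' => imp_congr_left ?_
  rw [seqLE_some_iff hG]
  exact or_iff_right fun e => h (congrArg Sigma.fst e)

theorem consistentActs_none (j : G.InfoSet i) : consistentActs none j = Finset.univ :=
  Finset.filter_true_of_mem fun _ _ _ h => h.elim

theorem prod_consistentActs_some (hG : G.PerfectRecall) {q : G.Sequence i → ℝ}
    (hq : q ∈ G.seqPolytope i) (j₀ : G.InfoSet i) (a₀ : G.Act j₀) :
    ∏ j, ∑ a ∈ consistentActs (some ⟨j₀, a₀⟩) j, behavior q ⟨j, a⟩ =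
      behavior q ⟨j₀, a₀⟩ * ∏ j, ∑ a ∈ consistentActs (parentSeq j₀) j, behavior q ⟨j, a⟩ := by
  have h1 : ∑ a ∈ consistentActs (some ⟨j₀, a₀⟩) j₀, behavior q ⟨j₀, a⟩ = behavior q ⟨j₀, a₀⟩ := by
    rw [consistentActs_self hG, Finset.sum_singleton]
  have h2 : ∑ a ∈ consistentActs (parentSeq j₀) j₀, behavior q ⟨j₀, a⟩ = 1 := by
    rw [consistentActs_parentSeq hG, sum_behavior hq]
  have h3 : ∀ j ∈ Finset.univ.erase j₀,
      ∑ a ∈ consistentActs (some ⟨j₀, a₀⟩) j, behavior q ⟨j, a⟩ =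
        ∑ a ∈ consistentActs (parentSeq j₀) j, behavior q ⟨j, a⟩ := fun j hj => by
    rw [consistentActs_of_ne hG a₀ (Finset.ne_of_mem_erase hj)]
  have h4 := Finset.mul_prod_erase Finset.univ
    (fun j => ∑ a ∈ consistentActs (some ⟨j₀, a₀⟩) j, behavior q ⟨j, a⟩) (Finset.mem_univ j₀)
  have h5 := Finset.mul_prod_erase Finset.univ
    (fun j => ∑ a ∈ consistentActs (parentSeq j₀) j, behavior q ⟨j, a⟩) (Finset.mem_univ j₀)
  calc _ = _ := h4.symm
    _ = behavior q ⟨j₀, a₀⟩ * ∏ j ∈ Finset.univ.erase j₀,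
        ∑ a ∈ consistentActs (parentSeq j₀) j, behavior q ⟨j, a⟩ :=
      congrArg₂ (· * ·) h1 (Finset.prod_congr rfl h3)
    _ = _ := congrArg (behavior q ⟨j₀, a₀⟩ * ·)
      ((one_mul _).symm.trans ((congrArg (· * _) h2.symm).trans h5))

/-- Independent draws at all information sets are consistent with `σ` with probability `q σ`. -/
theorem prod_consistentActs (hG : G.PerfectRecall) {q : G.Sequence i → ℝ}
    (hq : q ∈ G.seqPolytope i) (σ : G.Sequence i) :
    ∏ j, ∑ a ∈ consistentActs σ j, behavior q ⟨j, a⟩ = q σ := by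
  have base : ∏ j, ∑ a ∈ consistentActs (none : G.Sequence i) j, behavior q ⟨j, a⟩ = q none := by
    rw [hq.2.1]
    exact Finset.prod_eq_one fun j _ => by rw [consistentActs_none, sum_behavior hq]
  have hpar : ∀ j₀ : G.InfoSet i,
      ∏ j, ∑ a ∈ consistentActs (parentSeq j₀) j, behavior q ⟨j, a⟩ = q (parentSeq j₀) := by
    intro j₀
    induction j₀ using infoSet_induction hG with
    | step j₀ ih =>
      cases hp : parentSeq j₀ with
      | none => exact base
      | some ρ => rw [prod_consistentActs_some hG hq ρ.1 ρ.2, ih ρ hp, behavior_mul hq]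
  cases σ with
  | none => exact base
  | some τ => rw [prod_consistentActs_some hG hq τ.1 τ.2, hpar, behavior_mul hq]

/-- The natural sampling scheme is unbiased. -/
theorem sum_naturalSampling_mul (hG : G.PerfectRecall) {q : G.Sequence i → ℝ}
    (hq : q ∈ G.seqPolytope i) (σ : G.Sequence i) :
    ∑ p, naturalSampling q p * p.1 σ = q σ := by
  have h1 : ∀ p, naturalSampling q p * p.1 σ =
      ∑ b : (j : G.InfoSet i) → G.Act j with pureStrategyOf hG b = p,
        (∏ j, behavior q ⟨j, b j⟩) * pureOf b σ := by
    intro p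
    rw [naturalSampling_eq_sum hG hq, Finset.sum_mul]
    refine Finset.sum_congr rfl fun b hb => ?_
    rw [← (Finset.mem_filter.mp hb).2]
    rfl
  simp only [h1]
  rw [Finset.sum_fiberwise]
  simp only [pureOf, mul_ite, mul_one, mul_zero]
  rw [← Finset.sum_filter, ← prod_consistentActs hG hq σ,
    Finset.prod_univ_sum (consistentActs σ) fun j a => behavior q ⟨j, a⟩]
  congr 1
  ext b
  simp only [Finset.mem_filter, Finset.mem_univ, true_and, Fintype.mem_piFinset,
    mem_consistentActs]

theorem sum_naturalSampling_mul_linear (hG : G.PerfectRecall) {q : G.Sequence i → ℝ}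
    (hq : q ∈ G.seqPolytope i) (f : (G.Sequence i → ℝ) →ₗ[ℝ] ℝ) :
    ∑ p, naturalSampling q p * f p.1 = f q := by
  have h : ∑ p, naturalSampling q p • p.1 = q := by
    funext σ
    rw [Finset.sum_apply]
    exact sum_naturalSampling_mul hG hq σ
  conv_rhs => rw [← h]
  simp [map_sum]

end ExtGame

/-! ### Concentration for finite adaptive processes -/

section Concentration

/-- Hoeffding's lemma for a finitely supported distribution. -/
theorem sum_mul_exp_le_of_mem_Icc {ι : Type*} [Fintype ι] {w X : ι → ℝ} (hw0 : ∀ c, 0 ≤ w c)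
    (hw1 : ∑ c, w c = 1) {a b : ℝ} (hX : ∀ c, X c ∈ Set.Icc a b) (s : ℝ) :
    ∑ c, w c * Real.exp (s * (X c - ∑ d, w d * X d)) ≤
      Real.exp (s ^ 2 * (b - a) ^ 2 / 8) := by
  let _ : MeasurableSpace ι := ⊤
  have hsum : ∑ c, ENNReal.ofReal (w c) = 1 := by
    rw [← ENNReal.ofReal_sum_of_nonneg fun c _ => hw0 c, hw1, ENNReal.ofReal_one]
  let p : PMF ι := PMF.ofFintype (fun c => ENNReal.ofReal (w c)) hsum
  have hint : ∀ f : ι → ℝ, ∫ c, f c ∂p.toMeasure = ∑ c, w c * f c := fun f => by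
    rw [PMF.integral_eq_sum]
    refine Finset.sum_congr rfl fun c _ => ?_
    rw [PMF.ofFintype_apply, ENNReal.toReal_ofReal (hw0 c), smul_eq_mul]
  have h := (ProbabilityTheory.hasSubgaussianMGF_of_mem_Icc (μ := p.toMeasure) (X := X)
    (a := a) (b := b) (Measurable.aemeasurable fun _ _ => trivial)
    (Filter.Eventually.of_forall hX)).mgf_le s
  rw [ProbabilityTheory.mgf, hint, hint] at h
  refine h.trans (Real.exp_le_exp.mpr (le_of_eq ?_))
  simp only [NNReal.coe_pow, NNReal.coe_div, coe_nnnorm, NNReal.coe_ofNat, div_pow,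
    Real.norm_eq_abs, sq_abs]
  ring

/-- Under a product distribution, the expectation of `f` is bounded by any bound on its conditional
expectations given all the coordinates but one. -/
theorem sum_prod_mul_le_of_update {ι : Type*} [Fintype ι] [DecidableEq ι] {P : ι → Type*} [∀ k, Fintype (P k)]
    {w : (k : ι) → P k → ℝ} (hw0 : ∀ k c, 0 ≤ w k c) (hw1 : ∀ k, ∑ c, w k c = 1)
    (f : ((k : ι) → P k) → ℝ) (i : ι) {C : ℝ}
    (hf : ∀ p : (k : ι) → P k, ∑ c, w i c * f (Function.update p i c) ≤ C) :
    ∑ p : (k : ι) → P k, (∏ k, w k (p k)) * f p ≤ C := by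
  -- resampling the coordinate `i` leaves the distribution invariant
  let e : (((k : ι) → P k) × P i) → (((k : ι) → P k) × P i) := fun x =>
    (Function.update x.1 i x.2, x.1 i)
  have he : Function.Involutive e := fun x => by simp [e]
  have hW : ∀ x : ((k : ι) → P k) × P i,
      (∏ k, w k (Function.update x.1 i x.2 k)) * w i (x.1 i) = (∏ k, w k (x.1 k)) * w i x.2 := by
    intro x
    have h1 : ∀ y : (k : ι) → P k, (∏ k, w k (y k)) =
        w i (y i) * ∏ k ∈ Finset.univ.erase i, w k (y k) := fun y =>
      (Finset.mul_prod_erase _ _ (Finset.mem_univ i)).symm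
    have h2 : ∏ k ∈ Finset.univ.erase i, w k (Function.update x.1 i x.2 k) =
        ∏ k ∈ Finset.univ.erase i, w k (x.1 k) :=
      Finset.prod_congr rfl fun k hk => by
        rw [Function.update_of_ne (Finset.ne_of_mem_erase hk)]
    rw [h1, h1 x.1, h2, Function.update_self]
    ring
  have hres : ∑ p : (k : ι) → P k, (∏ k, w k (p k)) * f p =
      ∑ p : (k : ι) → P k, (∏ k, w k (p k)) * ∑ c, w i c * f (Function.update p i c) := by
    calc ∑ p : (k : ι) → P k, (∏ k, w k (p k)) * f p
        = ∑ x : ((k : ι) → P k) × P i, (∏ k, w k (x.1 k)) * w i x.2 * f x.1 := by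
          rw [Fintype.sum_prod_type]
          refine Finset.sum_congr rfl fun p _ => ?_
          dsimp only
          rw [← Finset.sum_mul, ← Finset.mul_sum, hw1, mul_one]
      _ = ∑ x : ((k : ι) → P k) × P i,
          (∏ k, w k (x.1 k)) * w i x.2 * f (Function.update x.1 i x.2) := by
          rw [← Equiv.sum_comp he.toPerm]
          refine Finset.sum_congr rfl fun x _ => ?_
          rw [← hW x]
          rfl
      _ = _ := by
          rw [Fintype.sum_prod_type]
          refine Finset.sum_congr rfl fun p _ => ?_
          rw [Finset.mul_sum]
          exact Finset.sum_congr rfl fun c _ => mul_assoc _ _ _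
  have htot : ∑ p : (k : ι) → P k, ∏ k, w k (p k) = 1 := by
    rw [← Fintype.piFinset_univ, ← Finset.prod_univ_sum (fun _ => Finset.univ) w]
    exact Finset.prod_eq_one fun k _ => hw1 k
  rw [hres]
  calc _ ≤ ∑ p : (k : ι) → P k, (∏ k, w k (p k)) * C :=
        Finset.sum_le_sum fun p _ =>
          mul_le_mul_of_nonneg_left (hf p) (Finset.prod_nonneg fun k _ => hw0 k _)
    _ = C := by rw [← Finset.sum_mul, htot, one_mul]

variable {P : Type*}

/-- The weight of a path, when `k hist p` is the weight of the step `p` after the steps `hist`. -/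
noncomputable def pathWeight (k : List P → P → ℝ) {T : ℕ} (x : Fin T → P) : ℝ :=
  ∏ t : Fin T, k ((List.ofFn x).take t) (x t)

theorem pathWeight_nonneg {k : List P → P → ℝ} (hk : ∀ hist p, 0 ≤ k hist p) {T : ℕ}
    (x : Fin T → P) : 0 ≤ pathWeight k x :=
  Finset.prod_nonneg fun _ _ => hk _ _

theorem pathWeight_snoc (k : List P → P → ℝ) {T : ℕ} (x : Fin T → P) (p : P) :
    pathWeight k (Fin.snoc x p : Fin (T + 1) → P) = pathWeight k x * k (List.ofFn x) p := by
  unfold pathWeight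
  have h : (fun s : Fin T => (Fin.snoc x p : Fin (T + 1) → P) s.castSucc) = x := by
    funext s
    simp
  rw [Fin.prod_univ_castSucc]
  congr 1
  · refine Finset.prod_congr rfl fun t _ => ?_
    rw [Fin.val_castSucc, take_ofFn_castSucc _ t.2.le, h, Fin.snoc_castSucc]
  · rw [Fin.val_last, take_ofFn_castSucc _ le_rfl, h, Fin.snoc_last,
      List.take_of_length_le (by simp)]

variable [Fintype P]

theorem sum_pathWeight_succ (k : List P → P → ℝ) (T : ℕ) :
    ∑ x : Fin (T + 1) → P, pathWeight k x =
      ∑ x : Fin T → P, pathWeight k x * ∑ p, k (List.ofFn x) p := by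
  rw [← (Fin.snocEquiv fun _ => P).sum_comp, Fintype.sum_prod_type_right]
  refine Finset.sum_congr rfl fun x _ => ?_
  rw [Finset.mul_sum]
  exact Finset.sum_congr rfl fun p _ => pathWeight_snoc k x p

theorem sum_pathWeight_eq_one {k : List P → P → ℝ} (hk : ∀ hist, ∑ p, k hist p = 1) (T : ℕ) :
    ∑ x : Fin T → P, pathWeight k x = 1 := by
  induction T with
  | zero => simp [pathWeight]
  | succ T ih =>
    rw [sum_pathWeight_succ]
    simp only [hk, mul_one, ih]

theorem sum_pathWeight_le_pow {k : List P → P → ℝ} (hk0 : ∀ hist p, 0 ≤ k hist p) {C : ℝ}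
    (hC : 0 ≤ C) (hk : ∀ hist, ∑ p, k hist p ≤ C) (T : ℕ) :
    ∑ x : Fin T → P, pathWeight k x ≤ C ^ T := by
  induction T with
  | zero => simp [pathWeight]
  | succ T ih =>
    rw [sum_pathWeight_succ, pow_succ]
    calc _ ≤ ∑ x : Fin T → P, pathWeight k x * C :=
          Finset.sum_le_sum fun x _ =>
            mul_le_mul_of_nonneg_left (hk _) (pathWeight_nonneg hk0 x)
      _ ≤ _ := by
          rw [← Finset.sum_mul]
          exact mul_le_mul_of_nonneg_right ih hC

/-- The Azuma–Hoeffding inequality for an adaptive process with finitely many outcomes: the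
increments `Z` have conditionally sub-Gaussian exponential moments with parameter `D ^ 2`. -/
theorem sum_pathWeight_filter_le {k Z : List P → P → ℝ} (hk0 : ∀ hist p, 0 ≤ k hist p) {D : ℝ}
    (hD : 0 < D) (hmgf : ∀ (s : ℝ) (hist), ∑ p, k hist p * Real.exp (s * Z hist p) ≤
      Real.exp (s ^ 2 * D ^ 2 / 2)) {T : ℕ} (hT : 0 < T) (B : ℝ) (hB : 0 ≤ B) :
    ∑ x : Fin T → P with D * √T * B ≤ ∑ t : Fin T, Z ((List.ofFn x).take t) (x t), pathWeight k x ≤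
      Real.exp (-(B ^ 2 / 2)) := by
  have hT' : 0 < √(T : ℝ) := Real.sqrt_pos.mpr (by exact_mod_cast hT)
  -- the exponent that minimizes the Chernoff bound
  set s : ℝ := B / (D * √T) with hs
  have hs0 : 0 ≤ s := by positivity
  have h1 : ∀ x : Fin T → P,
      pathWeight (fun hist p => k hist p * Real.exp (s * Z hist p)) x =
        pathWeight k x * Real.exp (s * ∑ t : Fin T, Z ((List.ofFn x).take t) (x t)) := by
    intro x
    unfold pathWeight
    rw [Finset.prod_mul_distrib, ← Real.exp_sum, Finset.mul_sum]
  have h2 := sum_pathWeight_le_pow (k := fun hist p => k hist p * Real.exp (s * Z hist p))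
    (fun hist p => mul_nonneg (hk0 _ _) (Real.exp_pos _).le) (Real.exp_pos _).le (hmgf s) T
  simp only [h1] at h2
  rw [← Real.exp_nat_mul] at h2
  have h3 : s * (D * √T * B) = B ^ 2 := by
    rw [hs]
    field_simp
  have h4 : (T : ℝ) * (s ^ 2 * D ^ 2 / 2) = B ^ 2 / 2 := by
    have h5 : √(T : ℝ) ^ 2 = T := Real.sq_sqrt (Nat.cast_nonneg _)
    rw [hs, div_pow, mul_pow, h5]
    have : (T : ℝ) ≠ 0 := by exact_mod_cast hT.ne'
    field_simp
  rw [h4] at h2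
  calc ∑ x : Fin T → P with D * √T * B ≤ ∑ t : Fin T, Z ((List.ofFn x).take t) (x t), pathWeight k x
      ≤ ∑ x : Fin T → P with D * √T * B ≤ ∑ t : Fin T, Z ((List.ofFn x).take t) (x t),
          Real.exp (-B ^ 2) *
            (pathWeight k x * Real.exp (s * ∑ t : Fin T, Z ((List.ofFn x).take t) (x t))) := by
        refine Finset.sum_le_sum fun x hx => ?_
        have h6 := mul_le_mul_of_nonneg_left (Finset.mem_filter.mp hx).2 hs0
        rw [h3] at h6
        have h7 : 1 ≤ Real.exp (-B ^ 2) *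
            Real.exp (s * ∑ t : Fin T, Z ((List.ofFn x).take t) (x t)) := by
          rw [← Real.exp_add]
          exact Real.one_le_exp (by linarith)
        have h8 := mul_le_mul_of_nonneg_left h7 (pathWeight_nonneg hk0 x)
        linarith
    _ ≤ ∑ x : Fin T → P, Real.exp (-B ^ 2) *
            (pathWeight k x * Real.exp (s * ∑ t : Fin T, Z ((List.ofFn x).take t) (x t))) :=
        Finset.sum_le_sum_of_subset_of_nonneg (Finset.filter_subset _ _) fun x _ _ =>
          mul_nonneg (Real.exp_pos _).le
            (mul_nonneg (pathWeight_nonneg hk0 x) (Real.exp_pos _).le)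
    _ ≤ Real.exp (-B ^ 2) * Real.exp (B ^ 2 / 2) := by
        rw [← Finset.mul_sum]
        exact mul_le_mul_of_nonneg_left h2 (Real.exp_pos _).le
    _ = _ := by
        rw [← Real.exp_add]
        congr 1
        ring

end Concentration

namespace ExtGame

variable {n : ℕ} {A K : Type u} {G : ExtGame n A K} {i : Fin n}

/-! ### Conditional moments of the sampled play -/

/-- The probability that the profile `p` is drawn after the profiles of `hist`; `playProb` is by
definition the corresponding `pathWeight`. -/
noncomputable def stepProb (F : G.Oracle) (ord : (i : Fin n) → List (G.InfoSet i))
    (hist : List G.Profile) (p : G.Profile) : ℝ :=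
  ∏ k, naturalSampling (mixedAt F ord hist k) (p k)

section Sampling

variable {F : G.Oracle} {ord : (i : Fin n) → List (G.InfoSet i)}

theorem mixedAt_mem (hG : G.PerfectRecall) (hF : F.Correct) (hord : ∀ i, TopDown (ord i))
    (hist : List G.Profile) (i : Fin n) : mixedAt F ord hist i ∈ G.seqPolytope i :=
  mixed_mem_seqPolytope hG hF (hord i) _

theorem stepProb_nonneg (hG : G.PerfectRecall) (hF : F.Correct) (hord : ∀ i, TopDown (ord i))
    (hist : List G.Profile) (p : G.Profile) : 0 ≤ stepProb F ord hist p :=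
  Finset.prod_nonneg fun k _ => naturalSampling_nonneg (mixedAt_mem hG hF hord hist k) _

theorem sum_stepProb (hG : G.PerfectRecall) (hF : F.Correct) (hord : ∀ i, TopDown (ord i))
    (hist : List G.Profile) : ∑ p, stepProb F ord hist p = 1 := by
  unfold stepProb
  rw [← Fintype.piFinset_univ, ← Finset.prod_univ_sum (fun _ => Finset.univ)
    fun k c => naturalSampling (mixedAt F ord hist k) c]
  exact Finset.prod_eq_one fun k _ => sum_naturalSampling hG (mixedAt_mem hG hF hord hist k)

theorem devGain_update (p : G.Profile) (c : G.PureStrategy i) (τ : G.NSeq i)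
    (y : SubSeq τ.1 → ℝ) : devGain (Function.update p i c) τ y = devGain p τ y := by
  have h : utility i (Function.update p i c) = utility i p := by
    refine LinearMap.ext fun x => ?_
    rw [utility_apply, utility_apply]
    refine Finset.sum_congr rfl fun z _ => ?_
    congr 2
    exact Finset.prod_congr rfl fun k hk => by
      rw [Function.update_of_ne (Finset.ne_of_mem_erase hk)]
  rw [devGain, devGain, h]

/-- Given the past and the draws of the other players, the gain of Player `i` from a fixed trigger
deviation of the sampled strategy is centred at the gain of the mixed strategy. -/
theorem sum_stepProb_mul_exp_le (hG : G.PerfectRecall) (hF : F.Correct)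
    (hord : ∀ i, TopDown (ord i)) (τ : G.NSeq i) {y : SubSeq τ.1 → ℝ}
    (hy : y ∈ subPolytope τ.1) (s : ℝ) (hist : List G.Profile) :
    ∑ p, stepProb F ord hist p * Real.exp (s *
      (devGain p τ y (p i).1 - devGain p τ y (mixedAt F ord hist i))) ≤
      Real.exp (s ^ 2 * G.payoffRange ^ 2 / 2) := by
  have hq := mixedAt_mem hG hF hord hist
  refine sum_prod_mul_le_of_update
    (w := fun k c => naturalSampling (mixedAt F ord hist k) c)
    (fun k c => naturalSampling_nonneg (hq k) c) (fun k => sum_naturalSampling hG (hq k))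
    _ i fun p => ?_
  simp only [devGain_update, Function.update_self]
  have h := sum_mul_exp_le_of_mem_Icc (fun c => naturalSampling_nonneg (hq i) c)
    (sum_naturalSampling hG (hq i)) (X := fun c : G.PureStrategy i => devGain p τ y c.1)
    (fun c => abs_le.mp (abs_devGain_le hG p τ hy c.2.1)) s
  rw [sum_naturalSampling_mul_linear hG (hq i) (devGain p τ y)] at h
  refine h.trans (Real.exp_le_exp.mpr (le_of_eq ?_))
  ring

end Sampling

/-! ### Equilibrium gap of the empirical frequency of play -/

theorem sum_filter_empirical {T : ℕ} (x : Fin T → G.Profile) (Q : G.Profile → Prop)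
    [DecidablePred Q] :
    ∑ p : G.Profile with Q p, empirical x p = 1 / (T : ℝ) * ∑ t, if Q (x t) then 1 else 0 := by
  simp only [empirical]
  rw [← Finset.mul_sum, Finset.sum_comm]
  congr 1
  refine Finset.sum_congr rfl fun t _ => ?_
  rw [Finset.sum_ite_eq]
  simp

theorem empirical_mem_stdSimplex {T : ℕ} (hT : 0 < T) (x : Fin T → G.Profile) :
    empirical x ∈ stdSimplex ℝ G.Profile := by
  constructor
  · intro p
    unfold empirical
    refine mul_nonneg (by positivity) (Finset.sum_nonneg fun t _ => ?_)
    split_ifs <;> norm_num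
  · have h := sum_filter_empirical x fun _ => True
    rw [Finset.filter_true] at h
    rw [h]
    have hT' : (T : ℝ) ≠ 0 := by exact_mod_cast hT.ne'
    simp [hT']

theorem prod_eq_ite_of_zero_or_one {ι : Type*} (s : Finset ι) {f : ι → ℝ}
    (hf : ∀ k, f k = 0 ∨ f k = 1) : ∏ k ∈ s, f k = if ∀ k ∈ s, f k = 1 then 1 else 0 := by
  split_ifs with h
  · exact Finset.prod_eq_one h
  · push Not at h
    obtain ⟨k, hk, h1⟩ := h
    exact Finset.prod_eq_zero hk ((hf k).resolve_right h1)

/-- The gain from a trigger deviation of a deterministic strategy, as the difference of the payoffs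
collected by the trigger agent below `j` and by following the recommendation below `(j, a)`. -/
theorem devGain_pure (p : G.Profile) (τ : G.NSeq i) (y : SubSeq τ.1 → ℝ) :
    devGain p τ y (p i).1 =
      (∑ z : G.Terminal with InfoLESeq τ.1 (G.termSeq i z), G.payoff i z.1 * G.chanceReach z.1 *
        ((if (∀ k, k ≠ i → (p k).1 (G.termSeq k z) = 1) ∧ (p i).1 (some τ) = 1 then 1 else 0) *
          entry y (G.termSeq i z))) -
      ∑ z : G.Terminal with SeqLE (some τ) (G.termSeq i z), G.payoff i z.1 * G.chanceReach z.1 *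
        (if ∀ k, (p k).1 (G.termSeq k z) = 1 then 1 else 0) := by
  rw [devGain_apply, utility_apply, utility_apply, ← Finset.sum_sub_distrib, Finset.sum_filter,
    Finset.sum_filter, ← Finset.sum_sub_distrib]
  refine Finset.sum_congr rfl fun z _ => ?_
  have h1 : ∏ k ∈ Finset.univ.erase i, (p k).1 (G.termSeq k z) =
      if ∀ k, k ≠ i → (p k).1 (G.termSeq k z) = 1 then 1 else 0 := by
    rw [prod_eq_ite_of_zero_or_one _ fun k => (p k).2.2 _]
    simp
  have h2 : (∀ k, (p k).1 (G.termSeq k z) = 1) ↔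
      (∀ k, k ≠ i → (p k).1 (G.termSeq k z) = 1) ∧ (p i).1 (G.termSeq i z) = 1 := by
    refine ⟨fun h => ⟨fun k _ => h k, h i⟩, fun h k => ?_⟩
    by_cases hk : k = i
    · subst hk
      exact h.2
    · exact h.1 k hk
  have h3 : ∀ σ, (if (p i).1 σ = 1 then 1 else 0) = (p i).1 σ := by
    intro σ
    rcases (p i).2.2 σ with h | h <;> simp [h]
  rw [h1, if_congr h2 rfl rfl, trigMap_apply, ite_and, ite_and, h3, h3]
  split_ifs <;> ring

theorem equilibrium_gap_empirical {T : ℕ} (x : Fin T → G.Profile) (τ : G.NSeq i)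
    (y : SubSeq τ.1 → ℝ) :
    (∑ z : G.Terminal with InfoLESeq τ.1 (G.termSeq i z),
        G.payoff i z.1 * G.chanceReach z.1 * triggerReach (empirical x) τ y z) -
      ∑ z : G.Terminal with SeqLE (some τ) (G.termSeq i z),
        G.payoff i z.1 * G.chanceReach z.1 * reach (empirical x) z =
      1 / (T : ℝ) * ∑ t, devGain (x t) τ y (x t i).1 := by
  simp only [devGain_pure, Finset.sum_sub_distrib, mul_sub]
  congr 1
  · rw [Finset.sum_comm, Finset.mul_sum]
    refine Finset.sum_congr rfl fun z _ => ?_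
    rw [triggerReach, sum_filter_empirical, ← Finset.mul_sum, ← Finset.sum_mul]
    ring
  · rw [Finset.sum_comm, Finset.mul_sum]
    refine Finset.sum_congr rfl fun z _ => ?_
    rw [reach, sum_filter_empirical, ← Finset.mul_sum]
    ring

/-- The empirical frequency of play is an `ε`-EFCE iff no deterministic trigger deviation has a total
gain above `ε T`. -/
theorem isEFCE_empirical_iff {T : ℕ} (hT : 0 < T) {ε : ℝ} (hε : 0 ≤ ε) (x : Fin T → G.Profile) :
    IsEFCE ε (empirical x) ↔ ∀ (i : Fin n) (τ : G.NSeq i), ∀ y ∈ subPure τ.1,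
      ∑ t, devGain (x t) τ y (x t i).1 ≤ ε * T := by
  have hT' : (0 : ℝ) < T := by exact_mod_cast hT
  have key : ∀ (i : Fin n) (τ : G.NSeq i) (y : SubSeq τ.1 → ℝ),
      (∑ z : G.Terminal with SeqLE (some τ) (G.termSeq i z),
          G.payoff i z.1 * G.chanceReach z.1 * reach (empirical x) z) ≥
        (∑ z : G.Terminal with InfoLESeq τ.1 (G.termSeq i z),
          G.payoff i z.1 * G.chanceReach z.1 * triggerReach (empirical x) τ y z) - ε ↔
      ∑ t, devGain (x t) τ y (x t i).1 ≤ ε * T := by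
    intro i τ y
    have h := equilibrium_gap_empirical x τ y
    rw [← div_le_iff₀ hT', div_eq_inv_mul, ← one_div, ← h]
    constructor <;> intro h' <;> linarith
  unfold IsEFCE
  simp only [key]
  exact ⟨fun h => h.2.2, fun h => ⟨hε, empirical_mem_stdSimplex hT x, h⟩⟩

/-! ### The law of the play -/

section Law

variable {F : G.Oracle} {ord : (i : Fin n) → List (G.InfoSet i)}

theorem playProb_nonneg (hG : G.PerfectRecall) (hF : F.Correct) (hord : ∀ i, TopDown (ord i))
    {T : ℕ} (x : Fin T → G.Profile) : 0 ≤ playProb F ord x :=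
  pathWeight_nonneg (stepProb_nonneg hG hF hord) x

theorem sum_playProb (hG : G.PerfectRecall) (hF : F.Correct) (hord : ∀ i, TopDown (ord i))
    (T : ℕ) : ∑ x : Fin T → G.Profile, playProb F ord x = 1 :=
  sum_pathWeight_eq_one (sum_stepProb hG hF hord) T

theorem playLaw_apply {T : ℕ} (S : Set (Fin T → G.Profile)) :
    playLaw F ord T S = ∑ x with x ∈ S, ENNReal.ofReal (playProb F ord x) := by
  rw [playLaw, MeasureTheory.Measure.finsetSum_apply, Finset.sum_filter]
  refine Finset.sum_congr rfl fun x _ => ?_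
  rw [MeasureTheory.Measure.smul_apply, MeasureTheory.Measure.dirac_apply, smul_eq_mul]
  split_ifs with h <;> simp [h]

theorem playLaw_real_apply (hG : G.PerfectRecall) (hF : F.Correct)
    (hord : ∀ i, TopDown (ord i)) {T : ℕ} (S : Set (Fin T → G.Profile)) :
    (playLaw F ord T).real S = ∑ x with x ∈ S, playProb F ord x := by
  rw [MeasureTheory.Measure.real, playLaw_apply,
    ← ENNReal.ofReal_sum_of_nonneg fun x _ => playProb_nonneg hG hF hord x,
    ENNReal.toReal_ofReal (Finset.sum_nonneg fun x _ => playProb_nonneg hG hF hord x)]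

theorem isProbabilityMeasure_playLaw (hG : G.PerfectRecall) (hF : F.Correct)
    (hord : ∀ i, TopDown (ord i)) (T : ℕ) :
    MeasureTheory.IsProbabilityMeasure (playLaw F ord T) := by
  constructor
  rw [playLaw_apply, ← ENNReal.ofReal_sum_of_nonneg fun x _ => playProb_nonneg hG hF hord x]
  simp [sum_playProb hG hF hord]

/-- A fixed trigger deviation is profitable by more than the regret bound plus `D √T B` with
probability at most `exp (-B² / 2)`. -/
theorem sum_playProb_devGain_le (hG : G.PerfectRecall) (hF : F.Correct)
    (hord : ∀ i, TopDown (ord i)) (τ : G.NSeq i) {y : SubSeq τ.1 → ℝ} (hy : y ∈ subPure τ.1)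
    {T : ℕ} (hT : 0 < T) {B : ℝ} (hB : 0 ≤ B) :
    ∑ x : Fin T → G.Profile with G.payoffRange * √T *
        (√(Fintype.card (G.NSeq i)) + Fintype.card (G.NSeq i) + B) <
          ∑ t, devGain (x t) τ y (x t i).1, playProb F ord x ≤ Real.exp (-(B ^ 2 / 2)) := by
  rcases (payoffRange_nonneg G).eq_or_lt with h0 | hD
  · -- without any variation of the payoffs no deviation is profitable
    rw [Finset.filter_false_of_mem, Finset.sum_empty]
    · exact (Real.exp_pos _).le
    · intro x _
      rw [← h0, zero_mul, zero_mul, not_lt]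
      refine Finset.sum_nonpos fun t _ => ?_
      exact h0 ▸ (abs_le.mp (abs_devGain_le hG (x t) τ hy.1 (x t i).2.1)).2
  · refine le_trans ?_ (sum_pathWeight_filter_le
      (Z := fun hist p => devGain p τ y (p i).1 - devGain p τ y (mixedAt F ord hist i))
      (stepProb_nonneg hG hF hord) hD
      (fun s hist => sum_stepProb_mul_exp_le hG hF hord τ hy.1 s hist) hT B hB)
    refine Finset.sum_le_sum_of_subset_of_nonneg (fun x hx => ?_)
      fun x _ _ => playProb_nonneg hG hF hord x
    have h1 := (Finset.mem_filter.mp hx).2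
    have h2 := sum_devGain_mixed_le hG hF hord τ hy x
    refine Finset.mem_filter.mpr ⟨Finset.mem_univ _, ?_⟩
    rw [Finset.sum_sub_distrib]
    rw [mul_add] at h1
    linarith

end Law

/-- A player with `N` nonempty sequences has at most `N 2 ^ N` deterministic trigger deviations; the
exponential factor is what the part of the bound that is independent of `δ` contributes. -/
theorem card_mul_two_pow_mul_exp_le (N : ℕ) :
    (N : ℝ) * 2 ^ N * Real.exp (-(((N : ℝ) + 3) / 2) ^ 2 / 2) ≤ 1 := by
  have h1 : (N : ℝ) * 2 ^ N ≤ Real.exp (2 * N * Real.log 2) := by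
    have h2 : (N : ℝ) ≤ 2 ^ N := by exact_mod_cast Nat.lt_two_pow_self.le
    have h3 : Real.exp (2 * N * Real.log 2) = 2 ^ N * 2 ^ N := by
      rw [← pow_add, ← two_mul, mul_comm, ← Real.rpow_natCast, Real.rpow_def_of_pos two_pos]
      push_cast
      rfl
    rw [h3]
    exact mul_le_mul_of_nonneg_right h2 (by positivity)
  calc _ ≤ Real.exp (2 * N * Real.log 2) * Real.exp (-(((N : ℝ) + 3) / 2) ^ 2 / 2) :=
        mul_le_mul_of_nonneg_right h1 (Real.exp_pos _).le
    _ ≤ 1 := by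
        rw [← Real.exp_add, Real.exp_le_one_iff]
        have h4 := Real.log_two_lt_d9
        have h5 : 2 * (N : ℝ) * Real.log 2 ≤ 2 * N * (3 / 4) :=
          mul_le_mul_of_nonneg_left (by linarith) (by positivity)
        -- `((N + 3) / 2) ^ 2 / 2 - 3 N / 2 = (N - 3) ^ 2 / 8`
        nlinarith [sq_nonneg ((N : ℝ) - 3)]

/-- A deterministic continuation strategy is the indicator function of a finite set. -/
theorem exists_eq_indicator {j : G.InfoSet i} {y : SubSeq j → ℝ} (hy : y ∈ subPure j) :
    ∃ s : Finset (SubSeq j), y = fun ρ => if ρ ∈ s then 1 else 0 := by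
  refine ⟨Finset.univ.filter fun ρ => y ρ = 1, funext fun ρ => ?_⟩
  rcases hy.2 ρ with h | h <;> simp [h]

section Union

variable {F : G.Oracle} {ord : (i : Fin n) → List (G.InfoSet i)}

/-- A fixed deterministic trigger deviation violates the equilibrium condition with a probability
that leaves room for a union bound over all deviations. -/
theorem sum_playProb_violation_le (hG : G.PerfectRecall) (hF : F.Correct)
    (hord : ∀ i, TopDown (ord i)) (τ : G.NSeq i) {y : SubSeq τ.1 → ℝ} (hy : y ∈ subPure τ.1)
    {T : ℕ} (hT : 0 < T) {L : ℝ} (hL : 0 ≤ L) :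
    ∑ x : Fin T → G.Profile with G.payoffRange * √T * (2 * (G.nodes.card : ℝ) + √(8 * L)) <
        ∑ t, devGain (x t) τ y (x t i).1, playProb F ord x ≤
      Real.exp (-(((Fintype.card (G.NSeq i) : ℝ) + 3) / 2) ^ 2 / 2) * Real.exp (-(4 * L)) := by
  have hNH : (Fintype.card (G.NSeq i) : ℝ) + 1 ≤ (G.nodes.card : ℝ) := by
    exact_mod_cast card_nseq_lt_card_nodes (G := G) i
  have hmain := fun B (hB : 0 ≤ B) => sum_playProb_devGain_le hG hF hord τ hy hT (B := B) hB
  have hN0 : (0 : ℝ) ≤ (Fintype.card (G.NSeq i) : ℝ) := Nat.cast_nonneg _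
  generalize (Fintype.card (G.NSeq i) : ℝ) = N at hNH hmain hN0 ⊢
  -- the regret is at most `D √T (√N + N)`, so that a deviation of size `D √T B` is left
  have hB0 : 0 ≤ (N + 3) / 2 + √(8 * L) := by positivity
  have hle : √N + N + ((N + 3) / 2 + √(8 * L)) ≤ 2 * (G.nodes.card : ℝ) + √(8 * L) := by
    have h1 : √N ≤ (N + 1) / 2 := by
      nlinarith [sq_nonneg (√N - 1), Real.sq_sqrt hN0]
    linarith
  have hexp : -(((N + 3) / 2 + √(8 * L)) ^ 2 / 2) ≤ -((N + 3) / 2) ^ 2 / 2 + -(4 * L) := by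
    have h1 : √(8 * L) ^ 2 = 8 * L := Real.sq_sqrt (by positivity)
    have h2 : 0 ≤ (N + 3) / 2 * √(8 * L) := by positivity
    rw [add_sq, h1]
    linarith
  rw [← Real.exp_add]
  refine le_trans ?_ ((hmain _ hB0).trans (Real.exp_le_exp.mpr hexp))
  refine Finset.sum_le_sum_of_subset_of_nonneg (fun x hx => ?_)
    fun x _ _ => playProb_nonneg hG hF hord x
  refine Finset.mem_filter.mpr ⟨Finset.mem_univ _, lt_of_le_of_lt ?_ (Finset.mem_filter.mp hx).2⟩
  exact mul_le_mul_of_nonneg_left hle (mul_nonneg (payoffRange_nonneg G) (Real.sqrt_nonneg _))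

/-- Union bound over the triggers `τ` and the deterministic continuations, the latter enumerated by
their supports. -/
theorem sum_playProb_exists_violation_le (hG : G.PerfectRecall) (hF : F.Correct)
    (hord : ∀ i, TopDown (ord i)) (i : Fin n) {T : ℕ} (hT : 0 < T) {L : ℝ} (hL : 0 ≤ L) :
    ∑ x : Fin T → G.Profile with (∃ τ : G.NSeq i, ∃ y ∈ subPure τ.1,
        G.payoffRange * √T * (2 * (G.nodes.card : ℝ) + √(8 * L)) <
          ∑ t, devGain (x t) τ y (x t i).1), playProb F ord x ≤ Real.exp (-(4 * L)) := by
  let Y : (τ : G.NSeq i) → Finset (SubSeq τ.1) → SubSeq τ.1 → ℝ := fun τ s ρ =>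
    if ρ ∈ s then 1 else 0
  let Bad : (τ : G.NSeq i) → Finset (SubSeq τ.1) → (Fin T → G.Profile) → Prop := fun τ s x =>
    Y τ s ∈ subPure τ.1 ∧ G.payoffRange * √T * (2 * (G.nodes.card : ℝ) + √(8 * L)) <
      ∑ t, devGain (x t) τ (Y τ s) (x t i).1
  have hp0 := fun x : Fin T → G.Profile => playProb_nonneg hG hF hord x
  set N : ℕ := Fintype.card (G.NSeq i) with hN
  set c : ℝ := Real.exp (-(((N : ℝ) + 3) / 2) ^ 2 / 2) * Real.exp (-(4 * L)) with hc
  have hc0 : 0 ≤ c := by positivity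
  have hbad : ∀ τ s, ∑ x with Bad τ s x, playProb F ord x ≤ c := by
    intro τ s
    by_cases hy : Y τ s ∈ subPure τ.1
    · refine le_trans (Finset.sum_le_sum_of_subset_of_nonneg (fun x hx => ?_)
        fun x _ _ => hp0 x) (sum_playProb_violation_le hG hF hord τ hy hT hL)
      exact Finset.mem_filter.mpr ⟨Finset.mem_univ _, (Finset.mem_filter.mp hx).2.2⟩
    · rw [Finset.sum_eq_zero fun x hx => absurd (Finset.mem_filter.mp hx).2.1 hy]
      exact hc0
  calc _ ≤ ∑ x with (∃ τ, ∃ s, Bad τ s x), playProb F ord x := by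
        refine Finset.sum_le_sum_of_subset_of_nonneg (fun x hx => ?_) fun x _ _ => hp0 x
        obtain ⟨τ, y, hy, hlt⟩ := (Finset.mem_filter.mp hx).2
        obtain ⟨s, rfl⟩ := exists_eq_indicator hy
        exact Finset.mem_filter.mpr ⟨Finset.mem_univ _, τ, s, hy, hlt⟩
    _ ≤ ∑ τ, ∑ s, ∑ x with Bad τ s x, playProb F ord x :=
        (sum_filter_exists_le (fun τ x => ∃ s, Bad τ s x) hp0).trans
          (Finset.sum_le_sum fun τ _ => sum_filter_exists_le (Bad τ) hp0)
    _ ≤ ∑ τ : G.NSeq i, ∑ s : Finset (SubSeq τ.1), c :=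
        Finset.sum_le_sum fun τ _ => Finset.sum_le_sum fun s _ => hbad τ s
    _ ≤ ∑ τ : G.NSeq i, (2 : ℝ) ^ N * c := by
        refine Finset.sum_le_sum fun τ _ => ?_
        rw [Finset.sum_const, Finset.card_univ, Fintype.card_finset, nsmul_eq_mul]
        push_cast
        exact mul_le_mul_of_nonneg_right
          (pow_le_pow_right₀ one_le_two (card_subSeq_le τ)) hc0
    _ = (N * 2 ^ N * Real.exp (-(((N : ℝ) + 3) / 2) ^ 2 / 2)) * Real.exp (-(4 * L)) := by
        rw [Finset.sum_const, Finset.card_univ, nsmul_eq_mul, hc]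
        ring
    _ ≤ 1 * Real.exp (-(4 * L)) :=
        mul_le_mul_of_nonneg_right (card_mul_two_pow_mul_exp_le N) (Real.exp_pos _).le
    _ = _ := one_mul _

theorem sum_playProb_not_isEFCE_le (hG : G.PerfectRecall) (hF : F.Correct)
    (hord : ∀ i, TopDown (ord i)) {T : ℕ} (hT : 0 < T) {δ : ℝ} (hδ0 : 0 < δ) (hδ1 : δ < 1) :
    ∑ x : Fin T → G.Profile with ¬ IsEFCE (G.payoffRange *
        ((2 * (G.nodes.card : ℝ) + √(8 * Real.log ((n : ℝ) / δ))) / √(T : ℝ))) (empirical x),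
      playProb F ord x ≤ δ := by
  have hT' : (0 : ℝ) < T := by exact_mod_cast hT
  have hD := payoffRange_nonneg G
  set L : ℝ := Real.log ((n : ℝ) / δ) with hL
  have hL0 : ∀ i : Fin n, 0 ≤ L := fun i => by
    have hn : (1 : ℝ) ≤ n := by exact_mod_cast i.pos
    exact Real.log_nonneg ((one_le_div hδ0).mpr (hδ1.le.trans hn))
  set ε : ℝ := G.payoffRange * ((2 * (G.nodes.card : ℝ) + √(8 * L)) / √(T : ℝ)) with hε
  have hε0 : 0 ≤ ε := by positivity
  have hεT : ε * T = G.payoffRange * √T * (2 * (G.nodes.card : ℝ) + √(8 * L)) := by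
    have h : √(T : ℝ) ≠ 0 := (Real.sqrt_pos.mpr hT').ne'
    rw [hε]
    field_simp
    rw [Real.sq_sqrt hT'.le]
  have hp0 := fun x : Fin T → G.Profile => playProb_nonneg hG hF hord x
  calc _ ≤ ∑ x : Fin T → G.Profile with (∃ i : Fin n, ∃ τ : G.NSeq i, ∃ y ∈ subPure τ.1,
          G.payoffRange * √T * (2 * (G.nodes.card : ℝ) + √(8 * L)) <
            ∑ t, devGain (x t) τ y (x t i).1), playProb F ord x := by
        refine Finset.sum_le_sum_of_subset_of_nonneg (fun x hx => ?_) fun x _ _ => hp0 x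
        have h := (Finset.mem_filter.mp hx).2
        rw [isEFCE_empirical_iff hT hε0, hεT] at h
        push Not at h
        exact Finset.mem_filter.mpr ⟨Finset.mem_univ _, h⟩
    _ ≤ ∑ i : Fin n, Real.exp (-(4 * L)) :=
        (sum_filter_exists_le _ hp0).trans (Finset.sum_le_sum fun i _ =>
          sum_playProb_exists_violation_le hG hF hord i hT (hL0 i))
    _ ≤ δ := by
        rw [Finset.sum_const, Finset.card_univ, Fintype.card_fin, nsmul_eq_mul]
        rcases Nat.eq_zero_or_pos n with h0 | h0
        · rw [h0, Nat.cast_zero, zero_mul]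
          exact hδ0.le
        · have hn : (0 : ℝ) < n := by exact_mod_cast h0
          have h1 : Real.exp (-(4 * L)) ≤ δ / n := by
            calc Real.exp (-(4 * L)) ≤ Real.exp (-L) :=
                  Real.exp_le_exp.mpr (by linarith [hL0 ⟨0, h0⟩])
              _ = δ / n := by rw [Real.exp_neg, hL, Real.exp_log (div_pos hn hδ0), inv_div]
          calc (n : ℝ) * Real.exp (-(4 * L)) ≤ n * (δ / n) :=
                mul_le_mul_of_nonneg_left h1 hn.le
            _ = δ := mul_div_cancel₀ δ hn.ne'

end Union

end ExtGame

theorem mainTheorem2 {n : ℕ} {A K : Type u} (G : ExtGame n A K) (hG : G.PerfectRecall)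
    (F : G.Oracle) (hF : F.Correct)
    (ord : (i : Fin n) → List (G.InfoSet i)) (hord : ∀ i, ExtGame.TopDown (ord i))
    (T : ℕ) (hT : 0 < T) (δ : ℝ) (hδ0 : 0 < δ) (hδ1 : δ < 1) :
    MeasureTheory.IsProbabilityMeasure (ExtGame.playLaw F ord T) ∧
      1 - δ ≤ (ExtGame.playLaw F ord T).real
        {x : Fin T → G.Profile |
          ExtGame.IsEFCE
            (G.payoffRange * ((2 * (G.nodes.card : ℝ) + √(8 * Real.log ((n : ℝ) / δ))) / √(T : ℝ)))
            (ExtGame.empirical x)} := by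
  refine ⟨ExtGame.isProbabilityMeasure_playLaw hG hF hord T, ?_⟩
  rw [ExtGame.playLaw_real_apply hG hF hord]
  simp only [Set.mem_ofPred_eq]
  have hfail := ExtGame.sum_playProb_not_isEFCE_le hG hF hord hT hδ0 hδ1
  have htot := ExtGame.sum_playProb hG hF hord T
  rw [← Finset.sum_filter_add_sum_filter_not Finset.univ
    (fun x : Fin T → G.Profile => ExtGame.IsEFCE (G.payoffRange *
      ((2 * (G.nodes.card : ℝ) + √(8 * Real.log ((n : ℝ) / δ))) / √(T : ℝ)))
        (ExtGame.empirical x))] at htot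
  linarith
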